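/- Let $k$ be an algebraically closed field of characteristic $0$, let $n\ge 0$, $\ell\ge 1$, and let $q\in k$ be a primitive $\ell$-th root of unity. Put $\theta(\epsilon_i,\epsilon_j)=q,1,q^{-1}$ according as $i>j$, $i=j$, $i<j$. Let $\bar{\mathscr A}_q(n)$ be the $n$-rank Taft algebra: the Hopf algebra over $k$ generated by $K(\epsilon_i)^{\pm1},x_i$ $(1\le i\le n)$ with relations $$K(\epsilon_i)K(\epsilon_j)=K(\epsilon_j)K(\epsilon_i),\quad K(\epsilon_i)^{\pm1}K(\epsilon_i)^{\mp1}=1,\quad K(\epsilon_i)^\ell=1,$$ $$K(\epsilon_i)x_jK(\epsilon_i)^{-1}=\theta(\epsilon_i,\epsilon_j)q^{\delta_{ij}}x_j,\quad x_ix_j=\theta(\epsilon_i,\epsilon_j)x_jx_i,\quad x_i^\ell=0,$$ and with $\Delta(K(\epsilon_i)^{\pm1})=K(\epsilon_i)^{\pm1}\otimes K(\epsilon_i)^{\pm1}$, $\Delta(x_i)=x_i\otimes 1+K(\epsilon_i)\otimes x_i$, $\varepsilon(K(\epsilon_i)^{\pm1})=1$, $\varepsilon(x_i)=0$, $s(K(\epsilon_i)^{\pm1})=K(\epsilon_i)^{\mp1}$,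 $s(x_i)=-K(\epsilon_i)^{-1}x_i$. For $H=\bar{\mathscr A}_q(n)$ let $D(H)$ be its Drinfel'd double, that is, $H^*\otimes H$ with the product $$(p\otimes h)(p'\otimes h')=\sum p\,\bigl(h_{(1)}\rightharpoonup p'\leftharpoonup s^{-1}(h_{(3)})\bigr)\otimes h_{(2)}h',$$ where $(h\rightharpoonup p)(a)=p(ah)$, $(p\leftharpoonup h)(a)=p(ha)$ and $H^*$ has the convolution product. For an algebra homomorphism $\chi:H\to k$ (a group-like element of $H^*$), let $H_\chi$ be the Yetter–Drinfel'd module with underlying space $H$, right coaction $\Delta$ and action $$h\bullet_\chi a=\sum (h_{(2)}\leftharpoonup\chi)\,a\,s^{-1}(h_{(1)}),\qquad h\leftharpoonup\chi=\sum\chi(h_{(1)})h_{(2)},$$ viewed as a left $D(H)$-module by $(p\otimes h)\cdot a=\sum p(b_{(2)})\,b_{(1)}$ with $b=h\bullet_\chi a$. For a group-like $g\in H$ put $H_{\chi,g}=H\bullet_\chi g$, a $D(H)$-submodule of $H_\chi$. For $\alpha,\beta\in\Lambda_+^{\le\kappa}=\{0,1,\dots,\ell-1\}^n$ let $K(\beta)=K(\epsilon_1)^{\beta_1}\cdots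 K(\epsilon_n)^{\beta_n}$, let $\mathcal K(\alpha):H\to k$ be the algebra homomorphism with $K(\epsilon_i)^{\pm1}\mapsto q^{\pm\alpha_i}$, $x_i\mapsto 0$, and put $\bar{\mathscr A}_{\alpha,\beta}=H_{\mathcal K(\alpha),K(\beta)}$. Then each $\bar{\mathscr A}_{\alpha,\beta}$, $\alpha,\beta\in\Lambda_+^{\le\kappa}$, is a simple left $D(\bar{\mathscr A}_q(n))$-module, and every simple left $D(\bar{\mathscr A}_q(n))$-module is isomorphic to some $\bar{\mathscr A}_{\alpha,\beta}$ with $\alpha,\beta\in\Lambda_+^{\le\kappa}$. -/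

import Mathlib

namespace TaftDouble

set_option linter.unusedSectionVars false

open TensorProduct Coalgebra WithConv HopfAlgebra

/-! ### The Drinfel'd double of a Hopf algebra with bijective antipode -/

/-- The antipode of `H` is bijective (automatic for finite-dimensional Hopf algebras). -/
class BijectiveAntipode (k H : Type*) [CommSemiring k] [Semiring H] [HopfAlgebra k H] : Prop where
  bijective : Function.Bijective (antipode k : H →ₗ[k] H)

section General

variable {k H : Type*} [Field k] [Ring H] [HopfAlgebra k H]

section Inv

variable [BijectiveAntipode k H]

/-- The inverse `s⁻¹` of the antipode, which is the antipode of `H` with opposite product. -/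
noncomputable def antipodeInv (k : Type*) {H : Type*} [Field k] [Ring H] [HopfAlgebra k H]
    [BijectiveAntipode k H] : H →ₗ[k] H :=
  ((LinearEquiv.ofBijective (antipode k : H →ₗ[k] H) BijectiveAntipode.bijective).symm :
    H ≃ₗ[k] H).toLinearMap

theorem antipode_antipodeInv (a : H) : antipode k (antipodeInv k a) = a :=
  LinearEquiv.apply_symm_apply
    (LinearEquiv.ofBijective (antipode k : H →ₗ[k] H) BijectiveAntipode.bijective) a

theorem antipode_inj {a b : H} (h : antipode k a = antipode k b) : a = b :=
  BijectiveAntipode.bijective (k := k).1 h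

theorem antipodeInv_mul (a b : H) :
    antipodeInv k (a * b) = antipodeInv k b * antipodeInv k a := by
  apply antipode_inj (k := k)
  rw [antipode_mul_antidistrib, antipode_antipodeInv, antipode_antipodeInv, antipode_antipodeInv]

theorem antipodeInv_one : antipodeInv k (1 : H) = 1 := by
  apply antipode_inj (k := k)
  rw [antipode_antipodeInv, antipode_one]

theorem sum_right_mul_antipodeInv {ι : Type*} {a : H} (r : Repr k a ι) :
    ∑ i ∈ r.index, r.right i * antipodeInv k (r.left i) = algebraMap k H (counit a) := by
  apply antipode_inj (k := k)
  rw [map_sum, Algebra.algebraMap_eq_smul_one, map_smul, antipode_one,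
    ← sum_mul_antipode_eq_smul r]
  simp [antipode_mul_antidistrib, antipode_antipodeInv]

theorem sum_antipodeInv_mul_left {ι : Type*} {a : H} (r : Repr k a ι) :
    ∑ i ∈ r.index, antipodeInv k (r.right i) * r.left i = algebraMap k H (counit a) := by
  apply antipode_inj (k := k)
  rw [map_sum, Algebra.algebraMap_eq_smul_one, map_smul, antipode_one,
    ← sum_antipode_mul_eq_smul r]
  simp [antipode_mul_antidistrib, antipode_antipodeInv]

end Inv

section Conv

variable {W : Type*} [AddCommMonoid W] [Module k W]

/-- The convolution product of two families of operators indexed by `H`: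
`h ↦ ∑ f (h₍₁₎) ∘ g (h₍₂₎)`. -/
noncomputable def conv (f g : H →ₗ[k] Module.End k W) : H →ₗ[k] Module.End k W :=
  (toConv f * toConv g).ofConv

theorem conv_apply (f g : H →ₗ[k] Module.End k W) {ι : Type*} {h : H} (r : Repr k h ι) :
    conv f g h = ∑ i ∈ r.index, f (r.left i) * g (r.right i) :=
  r.convMul_apply (toConv f) (toConv g)

theorem conv_assoc (f g l : H →ₗ[k] Module.End k W) :
    conv (conv f g) l = conv f (conv g l) :=
  congrArg ofConv (mul_assoc (toConv f) (toConv g) (toConv l))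

/-- The convolution unit `h ↦ ε(h) id`. -/
noncomputable def convUnit : H →ₗ[k] Module.End k W :=
  (1 : WithConv (H →ₗ[k] Module.End k W)).ofConv

theorem convUnit_apply (h : H) :
    (convUnit : H →ₗ[k] Module.End k W) h = (counit h : k) • (1 : Module.End k W) :=
  (LinearMap.convOne_apply h).trans (Algebra.algebraMap_eq_smul_one _)

theorem convUnit_conv (f : H →ₗ[k] Module.End k W) : conv convUnit f = f :=
  congrArg ofConv (one_mul (toConv f))

theorem conv_convUnit (f : H →ₗ[k] Module.End k W) : conv f convUnit = f :=
  congrArg ofConv (mul_one (toConv f))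

theorem lmulX_conv (X : Module.End k W) (f g : H →ₗ[k] Module.End k W) :
    conv (LinearMap.mulLeft k X ∘ₗ f) g = LinearMap.mulLeft k X ∘ₗ conv f g := by
  ext1 h
  simp [conv_apply _ _ (ℛ k h), mul_assoc]

theorem conv_rmulX (X : Module.End k W) (f g : H →ₗ[k] Module.End k W) :
    conv f (LinearMap.mulRight k X ∘ₗ g) = LinearMap.mulRight k X ∘ₗ conv f g := by
  ext1 h
  simp [conv_apply _ _ (ℛ k h), mul_assoc]

theorem conv_mid (X : Module.End k W) (f g : H →ₗ[k] Module.End k W) :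
    conv (LinearMap.mulRight k X ∘ₗ f) g = conv f (LinearMap.mulLeft k X ∘ₗ g) := by
  ext1 h
  simp [conv_apply _ _ (ℛ k h), mul_assoc]

theorem conv_map_one (f g : H →ₗ[k] Module.End k W) (hf : f 1 = 1) (hg : g 1 = 1) :
    conv f g 1 = 1 := by
  simp [conv, hf, hg, Algebra.TensorProduct.one_def]

theorem conv_map_mul (f g : H →ₗ[k] Module.End k W)
    (hf : ∀ a b, f (a * b) = f a * f b) (hg : ∀ a b, g (a * b) = g a * g b)
    (hfg : ∀ a b, f a * g b = g b * f a) (a b : H) :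
    conv f g (a * b) = conv f g a * conv f g b := by
  have key : ∀ x y : H ⊗[k] H,
      LinearMap.mul' k (Module.End k W) (TensorProduct.map f g (x * y)) =
        LinearMap.mul' k (Module.End k W) (TensorProduct.map f g x) *
          LinearMap.mul' k (Module.End k W) (TensorProduct.map f g y) := by
    intro x y
    induction x with
    | zero => simp
    | add x₁ x₂ h₁ h₂ => simp only [add_mul, map_add, h₁, h₂]
    | tmul x₁ x₂ =>
      induction y with
      | zero => simp
      | add y₁ y₂ h₁ h₂ => simp only [mul_add, map_add, h₁, h₂]
      | tmul y₁ y₂ =>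
        simp only [Algebra.TensorProduct.tmul_mul_tmul, TensorProduct.map_tmul,
          LinearMap.mul'_apply, hf, hg]
        rw [mul_assoc, mul_assoc, ← mul_assoc (f y₁), hfg y₁ x₂, mul_assoc]
  have := key (comul a) (comul b)
  rw [← Bialgebra.comul_mul] at this
  exact this

end Conv

/-! The dual `H*` with its convolution product and the two actions of `H` on it. -/

/-- The product of `H*`: `(p q)(a) = ∑ p(a₍₁₎) q(a₍₂₎)`, as a bilinear map. -/
noncomputable def dualMul : Module.Dual k H →ₗ[k] Module.Dual k H →ₗ[k] Module.Dual k H :=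
  LinearMap.mk₂ k (fun p q => (toConv p * toConv q).ofConv)
    (fun p p' q => congrArg ofConv (add_mul (toConv p) (toConv p') (toConv q)))
    (fun c p q => congrArg ofConv (smul_mul_assoc c (toConv p) (toConv q)))
    (fun p q q' => congrArg ofConv (mul_add (toConv p) (toConv q) (toConv q')))
    (fun c p q => congrArg ofConv (mul_smul_comm c (toConv p) (toConv q)))

theorem dualMul_apply (p q : Module.Dual k H) {ι : Type*} {a : H} (r : Repr k a ι) :
    dualMul p q a = ∑ i ∈ r.index, p (r.left i) * q (r.right i) :=
  r.convMul_apply (toConv p) (toConv q)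

theorem dualMul_assoc (p q r : Module.Dual k H) :
    dualMul (dualMul p q) r = dualMul p (dualMul q r) :=
  congrArg ofConv (mul_assoc (toConv p) (toConv q) (toConv r))

theorem counit_dualMul (p : Module.Dual k H) : dualMul counit p = p :=
  congrArg ofConv (one_mul (toConv p))

theorem dualMul_counit (p : Module.Dual k H) : dualMul p counit = p :=
  congrArg ofConv (mul_one (toConv p))

/-- The left action `(h ⇀ p)(a) = p(a h)` of `H` on `H*`, as a bilinear map. -/
noncomputable def hitL : H →ₗ[k] Module.Dual k H →ₗ[k] Module.Dual k H :=
  LinearMap.mk₂ k (fun h p => p ∘ₗ LinearMap.mulRight k h)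
    (fun _ _ _ => by ext; simp [mul_add]) (fun _ _ _ => by ext; simp)
    (fun _ _ _ => by ext; simp) (fun _ _ _ => by ext; simp)

/-- The right action `(p ↼ h)(a) = p(h a)` of `H` on `H*`, as a bilinear map. -/
noncomputable def hitR : H →ₗ[k] Module.Dual k H →ₗ[k] Module.Dual k H :=
  LinearMap.mk₂ k (fun h p => p ∘ₗ LinearMap.mulLeft k h)
    (fun _ _ _ => by ext; simp [add_mul]) (fun _ _ _ => by ext; simp)
    (fun _ _ _ => by ext; simp) (fun _ _ _ => by ext; simp)

@[simp] theorem hitL_apply (h : H) (p : Module.Dual k H) (a : H) : hitL h p a = p (a * h) := rfl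

@[simp] theorem hitR_apply (h : H) (p : Module.Dual k H) (a : H) : hitR h p a = p (h * a) := rfl

@[simp] theorem hitL_one (p : Module.Dual k H) : hitL 1 p = p := by ext; simp

@[simp] theorem hitR_one (p : Module.Dual k H) : hitR 1 p = p := by ext; simp

theorem hitL_hitL (a b : H) (p : Module.Dual k H) : hitL b (hitL a p) = hitL (b * a) p := by
  ext x; simp [mul_assoc]

theorem hitR_hitR (a b : H) (p : Module.Dual k H) : hitR b (hitR a p) = hitR (a * b) p := by
  ext x; simp [mul_assoc]

theorem hitL_hitR (a b : H) (p : Module.Dual k H) : hitL b (hitR a p) = hitR a (hitL b p) := by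
  ext x; simp [mul_assoc]


section Abstract

variable {W : Type*} [AddCommMonoid W] [Module k W]

theorem conv_factor (F L G M' M'' : H →ₗ[k] Module.End k W) (X : Module.End k W)
    (h₁ : conv M'' F = LinearMap.mulRight k X ∘ₗ F)
    (h₂ : LinearMap.mulRight k X ∘ₗ L = LinearMap.mulLeft k X ∘ₗ L)
    (h₃ : conv G M' = LinearMap.mulLeft k X ∘ₗ G) :
    conv (conv (conv F L) G) M' = conv M'' (conv (conv F L) G) := by
  rw [conv_assoc, h₃, conv_assoc F L, ← conv_mid X L G, h₂, lmulX_conv, ← conv_mid, ← h₁,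
    conv_assoc, conv_assoc]

theorem conv_inv_right (R R' M' : H →ₗ[k] Module.End k W) (X : Module.End k W)
    (h₁ : conv R R' = convUnit) (h₂ : conv R' R = convUnit)
    (h : conv M' R' = LinearMap.mulRight k X ∘ₗ R') :
    conv R M' = LinearMap.mulLeft k X ∘ₗ R := by
  rw [← conv_convUnit (conv R M'), ← h₂, conv_assoc, ← conv_assoc M', h, ← conv_assoc,
    conv_rmulX, h₁, conv_mid, convUnit_conv]

theorem conv_inv_left (R R' M'' : H →ₗ[k] Module.End k W) (X : Module.End k W)
    (h₁ : conv R R' = convUnit) (h₂ : conv R' R = convUnit)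
    (h : conv R' M'' = LinearMap.mulLeft k X ∘ₗ R') :
    conv M'' R = LinearMap.mulRight k X ∘ₗ R := by
  rw [← convUnit_conv (conv M'' R), ← h₁, conv_assoc, ← conv_assoc R', h, lmulX_conv, h₂,
    ← conv_mid, conv_convUnit]

variable [BijectiveAntipode k H]

/-- Commuting an operator of `H` past an operator of `H*`, from the Yetter-Drinfel'd
compatibility condition. -/
theorem cross_relation (A : H →ₗ[k] Module.End k W) (M : Module.Dual k H →ₗ[k] Module.End k W)
    (hYD : ∀ q, conv A (M ∘ₗ hitR.flip q) = conv (M ∘ₗ hitL.flip q) A)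
    {ι : Type*} {κ : ι → Type*} {h : H} (r : Repr k h ι) (s : ∀ i, Repr k (r.left i) (κ i))
    (q : Module.Dual k H) :
    ∑ i ∈ r.index, ∑ j ∈ (s i).index,
      M (hitL ((s i).left j) (hitR (antipodeInv k (r.right i)) q)) * A ((s i).right j) =
      A h * M q := by
  have e₁ : ∀ i, ∑ j ∈ (s i).index,
      M (hitL ((s i).left j) (hitR (antipodeInv k (r.right i)) q)) * A ((s i).right j) =
      ∑ j ∈ (s i).index,
        A ((s i).left j) * M (hitR (antipodeInv k (r.right i) * (s i).right j) q) := by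
    intro i
    have := LinearMap.congr_fun (hYD (hitR (antipodeInv k (r.right i)) q)) (r.left i)
    rw [conv_apply _ _ (s i), conv_apply _ _ (s i)] at this
    simpa [hitR_hitR] using this.symm
  rw [Finset.sum_congr rfl fun i _ => e₁ i]
  have e₂ := sum_tmul_tmul_eq r s (fun i => ℛ k (r.right i))
  let N : H →ₗ[k] Module.End k W := M ∘ₗ hitR.flip q
  have e₃ := congrArg (LinearMap.mul' k (Module.End k W) ∘ₗ TensorProduct.map A
    (N ∘ₗ LinearMap.mul' k H ∘ₗ (TensorProduct.comm k H H).toLinearMap ∘ₗ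
      TensorProduct.map LinearMap.id (antipodeInv k))) e₂
  simp only [map_sum, LinearMap.comp_apply, TensorProduct.map_tmul, LinearMap.id_apply,
    LinearEquiv.coe_coe, TensorProduct.comm_tmul, LinearMap.mul'_apply] at e₃
  refine (e₃.trans ?_)
  have e₄ : ∀ i, ∑ j ∈ (ℛ k (r.right i)).index, A (r.left i) *
      N (antipodeInv k ((ℛ k (r.right i)).right j) * (ℛ k (r.right i)).left j) =
      (counit (r.right i) : k) • (A (r.left i) * M q) := by
    intro i
    have hN : N 1 = M q := congrArg M (by ext; simp)
    rw [← Finset.mul_sum, ← map_sum, sum_antipodeInv_mul_left, Algebra.algebraMap_eq_smul_one,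
      map_smul, hN, mul_smul_comm]
  rw [Finset.sum_congr rfl fun i _ => e₄ i]
  have e₅ := congrArg (TensorProduct.rid k H) (sum_tmul_counit_eq r)
  simp only [map_sum, TensorProduct.rid_tmul, one_smul] at e₅
  conv_rhs => rw [← e₅]
  simp [Finset.sum_mul]

/-- Commuting an operator of `H*` past an operator of `H`, from the Yetter-Drinfel'd
compatibility condition. -/
theorem cross_relation' (A : H →ₗ[k] Module.End k W) (M : Module.Dual k H →ₗ[k] Module.End k W)
    (hYD : ∀ q, conv A (M ∘ₗ hitR.flip q) = conv (M ∘ₗ hitL.flip q) A)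
    {ι : Type*} {κ : ι → Type*} {h : H} (r : Repr k h ι) (t : ∀ i, Repr k (r.right i) (κ i))
    (q : Module.Dual k H) :
    ∑ i ∈ r.index, ∑ j ∈ (t i).index,
      A ((t i).left j) * M (hitR ((t i).right j) (hitL (antipodeInv k (r.left i)) q)) =
      M q * A h := by
  have e₁ : ∀ i, ∑ j ∈ (t i).index,
      A ((t i).left j) * M (hitR ((t i).right j) (hitL (antipodeInv k (r.left i)) q)) =
      ∑ j ∈ (t i).index,
        M (hitL ((t i).left j * antipodeInv k (r.left i)) q) * A ((t i).right j) := by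
    intro i
    have := LinearMap.congr_fun (hYD (hitL (antipodeInv k (r.left i)) q)) (r.right i)
    rw [conv_apply _ _ (t i), conv_apply _ _ (t i)] at this
    simpa [hitL_hitL] using this
  rw [Finset.sum_congr rfl fun i _ => e₁ i]
  have e₂ := (sum_tmul_tmul_eq r (fun i => ℛ k (r.left i)) t).symm
  let N : H →ₗ[k] Module.End k W := M ∘ₗ hitL.flip q
  have e₃ := congrArg (LinearMap.mul' k (Module.End k W) ∘ₗ TensorProduct.map
    (N ∘ₗ LinearMap.mul' k H ∘ₗ (TensorProduct.comm k H H).toLinearMap ∘ₗ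
      TensorProduct.map (antipodeInv k) LinearMap.id) A ∘ₗ
      (TensorProduct.assoc k H H H).symm.toLinearMap) e₂
  simp only [map_sum, LinearMap.comp_apply, TensorProduct.map_tmul, LinearMap.id_apply,
    LinearEquiv.coe_coe, TensorProduct.comm_tmul, LinearMap.mul'_apply,
    TensorProduct.assoc_symm_tmul] at e₃
  refine (e₃.trans ?_)
  have e₄ : ∀ i, ∑ j ∈ (ℛ k (r.left i)).index,
      N ((ℛ k (r.left i)).right j * antipodeInv k ((ℛ k (r.left i)).left j)) * A (r.right i) =
      (counit (r.left i) : k) • (M q * A (r.right i)) := by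
    intro i
    have hN : N 1 = M q := congrArg M (by ext; simp)
    rw [← Finset.sum_mul, ← map_sum, sum_right_mul_antipodeInv, Algebra.algebraMap_eq_smul_one,
      map_smul, hN, smul_mul_assoc]
  rw [Finset.sum_congr rfl fun i _ => e₄ i]
  conv_rhs => rw [← sum_counit_smul r]
  simp [Finset.mul_sum]

end Abstract

section Double

variable [BijectiveAntipode k H]

/-- `p' ⊗ h' ↦ (h ⇀ p') ⊗ h'`. -/
noncomputable def opHitL : H →ₗ[k] Module.End k (Module.Dual k H ⊗[k] H) :=
  LinearMap.rTensorHom H ∘ₗ hitL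

/-- `p' ⊗ h' ↦ p' ⊗ h h'`. -/
noncomputable def opMul : H →ₗ[k] Module.End k (Module.Dual k H ⊗[k] H) :=
  LinearMap.lTensorHom (Module.Dual k H) ∘ₗ LinearMap.mul k H

/-- `p' ⊗ h' ↦ (p' ↼ s⁻¹(h)) ⊗ h'`. -/
noncomputable def opHitR : H →ₗ[k] Module.End k (Module.Dual k H ⊗[k] H) :=
  LinearMap.rTensorHom H ∘ₗ hitR ∘ₗ antipodeInv k

/-- `q ⊗ l ↦ ∑ (h₍₁₎ ⇀ q ↼ s⁻¹(h₍₃₎)) ⊗ h₍₂₎ l`. -/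
noncomputable def opH : H →ₗ[k] Module.End k (Module.Dual k H ⊗[k] H) :=
  conv (conv opHitL opMul) opHitR

/-- `q ⊗ l ↦ p q ⊗ l`. -/
noncomputable def opDual : Module.Dual k H →ₗ[k] Module.End k (Module.Dual k H ⊗[k] H) :=
  LinearMap.rTensorHom H ∘ₗ dualMul

@[simp] theorem opHitL_tmul (h : H) (q : Module.Dual k H) (l : H) :
    opHitL h (q ⊗ₜ[k] l) = hitL h q ⊗ₜ l := rfl

@[simp] theorem opMul_tmul (h : H) (q : Module.Dual k H) (l : H) :
    opMul h (q ⊗ₜ[k] l) = q ⊗ₜ (h * l) := rfl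

@[simp] theorem opHitR_tmul (h : H) (q : Module.Dual k H) (l : H) :
    opHitR h (q ⊗ₜ[k] l) = hitR (antipodeInv k h) q ⊗ₜ l := rfl

@[simp] theorem opDual_tmul (p q : Module.Dual k H) (l : H) :
    opDual p (q ⊗ₜ[k] l) = dualMul p q ⊗ₜ l := rfl

theorem opH_tmul {ι : Type*} {κ : ι → Type*} {h : H} (r : Repr k h ι)
    (s : ∀ i, Repr k (r.left i) (κ i)) (q : Module.Dual k H) (l : H) :
    opH h (q ⊗ₜ[k] l) = ∑ i ∈ r.index, ∑ j ∈ (s i).index,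
      hitL ((s i).left j) (hitR (antipodeInv k (r.right i)) q) ⊗ₜ ((s i).right j * l) := by
  rw [opH, conv_apply _ _ r, LinearMap.sum_apply]
  refine Finset.sum_congr rfl fun i _ => ?_
  rw [conv_apply _ _ (s i), Finset.sum_mul, LinearMap.sum_apply]
  rfl

theorem opH_one : (opH (1 : H) : Module.End k (Module.Dual k H ⊗[k] H)) = 1 := by
  refine conv_map_one _ _ (conv_map_one _ _ ?_ ?_) ?_
  · ext; simp
  · ext; simp
  · ext; simp [antipodeInv_one]

theorem opH_mul (a b : H) : (opH (a * b) : Module.End k (Module.Dual k H ⊗[k] H)) =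
    opH a * opH b := by
  have h₁ : ∀ a b : H, (opHitL (a * b) : Module.End k (Module.Dual k H ⊗[k] H)) =
      opHitL a * opHitL b := by
    intro a b
    refine TensorProduct.ext' fun p l => ?_
    have : hitL (a * b) p = hitL a (hitL b p) := by ext; simp [mul_assoc]
    simp [this]
  have h₂ : ∀ a b : H, (opMul (a * b) : Module.End k (Module.Dual k H ⊗[k] H)) =
      opMul a * opMul b := by
    intro a b; ext; simp [mul_assoc]
  have h₃ : ∀ a b : H, (opHitR (a * b) : Module.End k (Module.Dual k H ⊗[k] H)) =
      opHitR a * opHitR b := by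
    intro a b
    refine TensorProduct.ext' fun p l => ?_
    simp [hitR_hitR, antipodeInv_mul]
  have c₁ : ∀ a b : H, (opHitL a : Module.End k (Module.Dual k H ⊗[k] H)) * opMul b =
      opMul b * opHitL a := by
    intro a b; ext; simp
  have c₂ : ∀ a b : H, (opHitL a : Module.End k (Module.Dual k H ⊗[k] H)) * opHitR b =
      opHitR b * opHitL a := by
    intro a b
    refine TensorProduct.ext' fun p l => ?_
    simp [hitL_hitR]
  have c₃ : ∀ a b : H, (opMul a : Module.End k (Module.Dual k H ⊗[k] H)) * opHitR b =
      opHitR b * opMul a := by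
    intro a b; ext; simp
  refine conv_map_mul _ _ (conv_map_mul _ _ h₁ h₂ c₁) h₃ (fun a b => ?_) a b
  simp only [conv_apply _ _ (ℛ k a), Finset.sum_mul, Finset.mul_sum]
  refine Finset.sum_congr rfl fun i _ => ?_
  rw [mul_assoc, c₃, ← mul_assoc, c₂, mul_assoc]

theorem opDual_mul (p q : Module.Dual k H) :
    (opDual (dualMul p q) : Module.End k (Module.Dual k H ⊗[k] H)) = opDual p * opDual q := by
  refine TensorProduct.ext' fun r l => ?_
  simp [dualMul_assoc]

theorem opDual_counit :
    (opDual counit : Module.End k (Module.Dual k H ⊗[k] H)) = 1 := by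
  refine TensorProduct.ext' fun r l => ?_
  simp [counit_dualMul]

theorem hitL_dualMul {ι : Type*} {h : H} (r : Repr k h ι) (p q : Module.Dual k H) :
    ∑ i ∈ r.index, dualMul (hitL (r.left i) p) (hitL (r.right i) q) = hitL h (dualMul p q) := by
  ext a
  change _ = LinearMap.mul' k k (TensorProduct.map p q (comul (a * h)))
  rw [Bialgebra.comul_mul, ← r.eq, ← (ℛ k a).eq]
  simp only [LinearMap.sum_apply, Finset.sum_mul, Finset.mul_sum, map_sum,
    Algebra.TensorProduct.tmul_mul_tmul, TensorProduct.map_tmul, LinearMap.mul'_apply,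
    dualMul_apply _ _ (ℛ k a), hitL_apply]

theorem hitR_dualMul {ι : Type*} {h : H} (r : Repr k h ι) (p q : Module.Dual k H) :
    ∑ i ∈ r.index, dualMul (hitR (r.left i) p) (hitR (r.right i) q) = hitR h (dualMul p q) := by
  ext a
  change _ = LinearMap.mul' k k (TensorProduct.map p q (comul (h * a)))
  rw [Bialgebra.comul_mul, ← r.eq, ← (ℛ k a).eq]
  simp only [LinearMap.sum_apply, Finset.sum_mul, Finset.mul_sum, map_sum,
    Algebra.TensorProduct.tmul_mul_tmul, TensorProduct.map_tmul, LinearMap.mul'_apply,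
    dualMul_apply _ _ (ℛ k a), hitR_apply]
  exact Finset.sum_comm

theorem opH_compat (q : Module.Dual k H) :
    conv (opH : H →ₗ[k] Module.End k (Module.Dual k H ⊗[k] H)) (opDual ∘ₗ hitR.flip q) =
      conv (opDual ∘ₗ hitL.flip q) opH := by
  have hRT : ∀ (f : Module.Dual k H →ₗ[k] Module.Dual k H) (p : Module.Dual k H) (l : H),
      LinearMap.rTensorHom H f (p ⊗ₜ[k] l) = f p ⊗ₜ l := fun _ _ _ => rfl
  refine conv_factor _ _ _ _ _ (opDual q) ?_ ?_ ?_
  · ext1 h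
    refine TensorProduct.ext' fun p l => ?_
    simp [conv_apply _ _ (ℛ k h), ← TensorProduct.sum_tmul, hitL_dualMul]
  · ext1 h
    refine TensorProduct.ext' fun p l => ?_
    simp
  · refine conv_inv_right _ (LinearMap.rTensorHom H ∘ₗ hitR) _ _ ?_ ?_ ?_
    · ext1 h
      refine TensorProduct.ext' fun p l => ?_
      have h1 : ∑ i ∈ (ℛ k h).index, hitR (antipodeInv k ((ℛ k h).left i))
          (hitR ((ℛ k h).right i) p) = (counit h : k) • p := by
        simp_rw [hitR_hitR]
        rw [← LinearMap.sum_apply, ← map_sum, sum_right_mul_antipodeInv]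
        ext; simp [Algebra.algebraMap_eq_smul_one]
      simp only [conv_apply _ _ (ℛ k h), convUnit_apply, LinearMap.sum_apply, Module.End.mul_apply,
        LinearMap.comp_apply, hRT, opHitR_tmul,
        LinearMap.smul_apply, Module.End.one_apply]
      rw [← TensorProduct.sum_tmul, h1, TensorProduct.smul_tmul']
    · ext1 h
      refine TensorProduct.ext' fun p l => ?_
      have h1 : ∑ i ∈ (ℛ k h).index, hitR ((ℛ k h).left i)
          (hitR (antipodeInv k ((ℛ k h).right i)) p) = (counit h : k) • p := by
        simp_rw [hitR_hitR]
        rw [← LinearMap.sum_apply, ← map_sum, sum_antipodeInv_mul_left]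
        ext; simp [Algebra.algebraMap_eq_smul_one]
      simp only [conv_apply _ _ (ℛ k h), convUnit_apply, LinearMap.sum_apply, Module.End.mul_apply,
        LinearMap.comp_apply, hRT, opHitR_tmul,
        LinearMap.smul_apply, Module.End.one_apply]
      rw [← TensorProduct.sum_tmul, h1, TensorProduct.smul_tmul']
    · ext1 h
      refine TensorProduct.ext' fun p l => ?_
      simp [conv_apply _ _ (ℛ k h), ← TensorProduct.sum_tmul, hitR_dualMul]

/-- For operators `A` of `H` and `M` of `H*`, the operators `p ⊗ h ↦ M(p) A(h)`. -/
noncomputable def liftOp {W : Type*} [AddCommMonoid W] [Module k W]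
    (M : Module.Dual k H →ₗ[k] Module.End k W) (A : H →ₗ[k] Module.End k W) :
    Module.Dual k H ⊗[k] H →ₗ[k] Module.End k W :=
  LinearMap.mul' k (Module.End k W) ∘ₗ TensorProduct.map M A

@[simp] theorem liftOp_tmul {W : Type*} [AddCommMonoid W] [Module k W]
    (M : Module.Dual k H →ₗ[k] Module.End k W) (A : H →ₗ[k] Module.End k W)
    (p : Module.Dual k H) (h : H) : liftOp M A (p ⊗ₜ[k] h) = M p * A h := rfl

/-- The product of the double on `H* ⊗ H`:
`(p ⊗ h)(q ⊗ l) = ∑ p (h₍₁₎ ⇀ q ↼ s⁻¹(h₍₃₎)) ⊗ h₍₂₎ l`. -/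
noncomputable def doubleMul :
    Module.Dual k H ⊗[k] H →ₗ[k] Module.Dual k H ⊗[k] H →ₗ[k] Module.Dual k H ⊗[k] H :=
  liftOp opDual opH

/-- The explicit formula for the product of the double. -/
theorem doubleMul_tmul {ι : Type*} {κ : ι → Type*} {h : H} (r : Repr k h ι)
    (s : ∀ i, Repr k (r.left i) (κ i)) (p q : Module.Dual k H) (l : H) :
    doubleMul (p ⊗ₜ[k] h) (q ⊗ₜ[k] l) = ∑ i ∈ r.index, ∑ j ∈ (s i).index,
      dualMul p (hitL ((s i).left j) (hitR (antipodeInv k (r.right i)) q)) ⊗ₜ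
        ((s i).right j * l) := by
  change opDual p (opH h (q ⊗ₜ[k] l)) = _
  rw [opH_tmul r s]
  simp

theorem liftOp_mul {W : Type*} [AddCommMonoid W] [Module k W]
    (M : Module.Dual k H →ₗ[k] Module.End k W) (A : H →ₗ[k] Module.End k W)
    (hA : ∀ a b, A (a * b) = A a * A b) (hM : ∀ p q, M (dualMul p q) = M p * M q)
    (hYD : ∀ q, conv A (M ∘ₗ hitR.flip q) = conv (M ∘ₗ hitL.flip q) A)
    (d e : Module.Dual k H ⊗[k] H) :
    liftOp M A (doubleMul d e) = liftOp M A d * liftOp M A e := by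
  induction d with
  | zero => simp
  | add d₁ d₂ h₁ h₂ => simp only [map_add, LinearMap.add_apply, h₁, h₂, add_mul]
  | tmul p h =>
    induction e with
    | zero => simp
    | add e₁ e₂ h₁ h₂ => simp only [map_add, h₁, h₂, mul_add]
    | tmul q l =>
      rw [doubleMul_tmul (ℛ k h) (fun i => ℛ k ((ℛ k h).left i))]
      have := cross_relation A M hYD (ℛ k h) (fun i => ℛ k ((ℛ k h).left i)) q
      simp only [map_sum, liftOp_tmul, hA, hM]
      rw [mul_assoc, ← mul_assoc (A h), ← this]
      simp only [Finset.mul_sum, Finset.sum_mul, mul_assoc]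

theorem doubleMul_assoc (d e f : Module.Dual k H ⊗[k] H) :
    doubleMul (doubleMul d e) f = doubleMul d (doubleMul e f) :=
  LinearMap.congr_fun (liftOp_mul opDual opH opH_mul opDual_mul opH_compat d e) f

theorem one_doubleMul (d : Module.Dual k H ⊗[k] H) :
    doubleMul (counit ⊗ₜ[k] (1 : H)) d = d := by
  change (opDual counit * opH 1 : Module.End k (Module.Dual k H ⊗[k] H)) d = d
  rw [opDual_counit, opH_one]
  rfl

theorem doubleMul_one (d : Module.Dual k H ⊗[k] H) :
    doubleMul d (counit ⊗ₜ[k] (1 : H)) = d := by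
  induction d with
  | zero => simp
  | add d₁ d₂ h₁ h₂ => simp only [map_add, LinearMap.add_apply, h₁, h₂]
  | tmul p h =>
    have e₁ : ∀ a : H, hitL a (counit : Module.Dual k H) = (counit a : k) • counit := by
      intro a; ext; simp [mul_comm]
    have e₂ : ∀ a : H, hitR (antipodeInv k a) (counit : Module.Dual k H) =
        (counit a : k) • counit := by
      intro a; ext
      have := counit_antipode (R := k) (antipodeInv k a)
      rw [antipode_antipodeInv] at this
      simp [this]
    rw [doubleMul_tmul (ℛ k h) (fun i => ℛ k ((ℛ k h).left i))]
    simp only [e₁, e₂, map_smul, dualMul_counit, mul_one, smul_smul]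
    simp only [TensorProduct.smul_tmul, ← TensorProduct.tmul_sum]
    congr 1
    simp only [mul_smul, ← Finset.smul_sum, sum_counit_smul]
    have e₅ := congrArg (TensorProduct.rid k H) (sum_tmul_counit_eq (ℛ k h))
    simpa only [map_sum, TensorProduct.rid_tmul, one_smul] using e₅

end Double

end General

/-- The Drinfel'd double `D(H) = (H*)^cop ⋈ H`, with underlying space `H* ⊗ H`. Only its algebra
structure is recorded, since this is all that enters the notion of a `D(H)`-module. -/
def DrinfeldDouble (k H : Type*) [Field k] [Ring H] [HopfAlgebra k H] : Type _ :=
  Module.Dual k H ⊗[k] H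

section DoubleRing

variable {k H : Type*} [Field k] [Ring H] [HopfAlgebra k H]

noncomputable instance : AddCommGroup (DrinfeldDouble k H) :=
  inferInstanceAs (AddCommGroup (Module.Dual k H ⊗[k] H))

noncomputable instance : Module k (DrinfeldDouble k H) :=
  inferInstanceAs (Module k (Module.Dual k H ⊗[k] H))

/-- The identification of the underlying space of `D(H)` with `H* ⊗ H`. -/
noncomputable def DrinfeldDouble.equiv (k H : Type*) [Field k] [Ring H] [HopfAlgebra k H] :
    DrinfeldDouble k H ≃ₗ[k] Module.Dual k H ⊗[k] H :=
  LinearEquiv.refl k _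

variable [BijectiveAntipode k H]

noncomputable instance : Ring (DrinfeldDouble k H) where
  mul d e := (DrinfeldDouble.equiv k H).symm
    (doubleMul (DrinfeldDouble.equiv k H d) (DrinfeldDouble.equiv k H e))
  one := (DrinfeldDouble.equiv k H).symm (counit ⊗ₜ[k] (1 : H))
  mul_assoc := doubleMul_assoc (k := k) (H := H)
  one_mul := one_doubleMul (k := k) (H := H)
  mul_one := doubleMul_one (k := k) (H := H)
  left_distrib a b c := map_add (doubleMul (k := k) (H := H) a) b c
  right_distrib a b c := LinearMap.map_add₂ (doubleMul (k := k) (H := H)) a b c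
  zero_mul a := LinearMap.map_zero₂ (doubleMul (k := k) (H := H)) a
  mul_zero a := map_zero (doubleMul (k := k) (H := H) a)
  neg_add_cancel := neg_add_cancel
  zsmul := zsmulRec

noncomputable instance : Algebra k (DrinfeldDouble k H) :=
  Algebra.ofModule
    (fun c d e => LinearMap.map_smul₂ (doubleMul (k := k) (H := H)) c d e)
    (fun c d e => map_smul (doubleMul (k := k) (H := H) d) c e)

end DoubleRing

/-! ### Radford's Yetter-Drinfel'd modules -/

section Radford

variable {k H : Type*} [Field k] [Ring H] [HopfAlgebra k H] [BijectiveAntipode k H]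

/-- The family of operators `a ↦ a s⁻¹(h)` on `H`. -/
noncomputable def rightOp : H →ₗ[k] Module.End k H :=
  (LinearMap.mul k H).flip ∘ₗ antipodeInv k

/-- The family of scalar operators `a ↦ χ(h) a` on `H`. -/
noncomputable def scalarOp (χ : H →ₐ[k] k) : H →ₗ[k] Module.End k H :=
  Algebra.linearMap k (Module.End k H) ∘ₗ χ.toLinearMap

/-- The action `h •_χ a = ∑ (h₍₂₎ ↼ χ) a s⁻¹(h₍₁₎)` of `H` on `H`, where
`h ↼ χ = ∑ χ(h₍₁₎) h₍₂₎`; equivalently `h •_χ a = ∑ χ(h₍₂₎) h₍₃₎ a s⁻¹(h₍₁₎)`. -/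
noncomputable def bullet (χ : H →ₐ[k] k) : H →ₗ[k] Module.End k H :=
  conv (conv rightOp (scalarOp χ)) (LinearMap.mul k H)

/-- The explicit formula for the action `•_χ`. -/
theorem bullet_apply (χ : H →ₐ[k] k) {ι : Type*} {κ : ι → Type*} {h : H} (r : Repr k h ι)
    (s : ∀ i, Repr k (r.right i) (κ i)) (a : H) :
    bullet χ h a = ∑ i ∈ r.index,
      (∑ j ∈ (s i).index, χ ((s i).left j) • (s i).right j) * a * antipodeInv k (r.left i) := by
  rw [bullet, conv_assoc, conv_apply _ _ r, LinearMap.sum_apply]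
  refine Finset.sum_congr rfl fun i _ => ?_
  rw [conv_apply _ _ (s i)]
  simp [rightOp, scalarOp, Finset.sum_mul]

/-- The action `p · a = ∑ p(a₍₂₎) a₍₁₎` of `H*` on `H` that corresponds to the right coaction
`Δ` of `H` on itself. -/
noncomputable def coactOp : Module.Dual k H →ₗ[k] Module.End k H :=
  LinearMap.mk₂ k (fun p a => TensorProduct.rid k H (LinearMap.lTensor H p (comul a)))
    (fun p q a => by simp [LinearMap.lTensor_add])
    (fun c p a => by simp [LinearMap.lTensor_smul])
    (fun p a b => by simp) (fun c p a => by simp)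

theorem coactOp_apply (p : Module.Dual k H) {ι : Type*} {a : H} (r : Repr k a ι) :
    coactOp p a = ∑ i ∈ r.index, p (r.right i) • r.left i := by
  change TensorProduct.rid k H (LinearMap.lTensor H p (comul a)) = _
  rw [← r.eq]
  simp

theorem coactOp_counit : (coactOp counit : Module.End k H) = 1 := by
  ext a
  change TensorProduct.rid k H (LinearMap.lTensor H counit (comul a)) = _
  simp

theorem coactOp_mul (p q : Module.Dual k H) :
    (coactOp (dualMul p q) : Module.End k H) = coactOp p * coactOp q := by
  ext a
  have e := sum_tmul_tmul_eq (ℛ k a) (fun i => ℛ k ((ℛ k a).left i))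
    (fun i => ℛ k ((ℛ k a).right i))
  have e' := congrArg ((TensorProduct.rid k H).toLinearMap ∘ₗ LinearMap.lTensor H
    (LinearMap.mul' k k ∘ₗ TensorProduct.map p q)) e
  simp only [map_sum, LinearMap.comp_apply, LinearMap.lTensor_tmul, TensorProduct.map_tmul,
    LinearMap.mul'_apply, LinearEquiv.coe_coe, TensorProduct.rid_tmul] at e'
  rw [Module.End.mul_apply, coactOp_apply _ (ℛ k a), coactOp_apply _ (ℛ k a)]
  simp only [dualMul_apply p q (ℛ k ((ℛ k a).right _)), map_sum, map_smul,
    coactOp_apply p (ℛ k ((ℛ k a).left _)), Finset.sum_smul, Finset.smul_sum, smul_smul]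
  rw [← e']
  simp only [mul_comm]

theorem bullet_one (χ : H →ₐ[k] k) : bullet χ 1 = 1 := by
  refine conv_map_one _ _ (conv_map_one _ _ ?_ ?_) ?_
  · ext; simp [rightOp, antipodeInv_one]
  · ext; simp [scalarOp]
  · ext; simp

theorem bullet_mul (χ : H →ₐ[k] k) (a b : H) :
    bullet χ (a * b) = bullet χ a * bullet χ b := by
  have c₁ : ∀ a b : H, (rightOp a : Module.End k H) * scalarOp χ b = scalarOp χ b * rightOp a := by
    intro a b; ext; simp [rightOp, scalarOp]
  refine conv_map_mul _ _ (conv_map_mul _ _ ?_ ?_ c₁) ?_ (fun a b => ?_) a b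
  · intro a b; ext; simp [rightOp, antipodeInv_mul, mul_assoc]
  · intro a b; ext; simp [scalarOp]
  · intro a b; ext; simp [mul_assoc]
  · simp only [conv_apply _ _ (ℛ k a), Finset.sum_mul, Finset.mul_sum]
    refine Finset.sum_congr rfl fun i _ => ?_
    ext; simp [rightOp, scalarOp, mul_assoc]

theorem coactOp_mul_arg (q : Module.Dual k H) (a h : H) :
    coactOp q (a * h) = ∑ i ∈ (ℛ k h).index,
      coactOp (hitL ((ℛ k h).right i) q) a * (ℛ k h).left i := by
  change TensorProduct.rid k H (LinearMap.lTensor H q (comul (a * h))) = _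
  rw [Bialgebra.comul_mul]
  nth_rw 1 [← (ℛ k h).eq]
  nth_rw 1 [← (ℛ k a).eq]
  simp only [coactOp_apply _ (ℛ k a), Finset.sum_mul, Finset.mul_sum, map_sum,
    Algebra.TensorProduct.tmul_mul_tmul, LinearMap.lTensor_tmul, TensorProduct.rid_tmul,
    hitL_apply, smul_mul_assoc]

theorem coactOp_arg_mul (q : Module.Dual k H) (a h : H) :
    coactOp q (h * a) = ∑ i ∈ (ℛ k h).index,
      (ℛ k h).left i * coactOp (hitR ((ℛ k h).right i) q) a := by
  change TensorProduct.rid k H (LinearMap.lTensor H q (comul (h * a))) = _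
  rw [Bialgebra.comul_mul]
  nth_rw 1 [← (ℛ k h).eq]
  nth_rw 1 [← (ℛ k a).eq]
  simp only [coactOp_apply _ (ℛ k a), Finset.sum_mul, Finset.mul_sum, map_sum,
    Algebra.TensorProduct.tmul_mul_tmul, LinearMap.lTensor_tmul, TensorProduct.rid_tmul,
    hitR_apply, mul_smul_comm]
  exact Finset.sum_comm

/-- The Yetter-Drinfel'd compatibility of `•_χ` and the coaction `Δ`. -/
theorem bullet_compat (χ : H →ₐ[k] k) (q : Module.Dual k H) :
    conv (bullet χ) (coactOp ∘ₗ hitR.flip q) = conv (coactOp ∘ₗ hitL.flip q) (bullet χ) := by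
  refine conv_factor _ _ _ _ _ (coactOp q) ?_ ?_ ?_
  · refine conv_inv_left _ (LinearMap.mul k H).flip _ _ ?_ ?_ ?_
    · ext1 h; ext1 a
      simp only [conv_apply _ _ (ℛ k h), convUnit_apply, LinearMap.sum_apply, Module.End.mul_apply,
        rightOp, LinearMap.comp_apply, LinearMap.flip_apply, LinearMap.mul_apply', mul_assoc,
        ← Finset.mul_sum, sum_right_mul_antipodeInv, LinearMap.smul_apply, Module.End.one_apply,
        Algebra.algebraMap_eq_smul_one, mul_smul_comm, mul_one]
    · ext1 h; ext1 a
      simp only [conv_apply _ _ (ℛ k h), convUnit_apply, LinearMap.sum_apply, Module.End.mul_apply,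
        rightOp, LinearMap.comp_apply, LinearMap.flip_apply, LinearMap.mul_apply', mul_assoc,
        ← Finset.mul_sum, sum_antipodeInv_mul_left, LinearMap.smul_apply, Module.End.one_apply,
        Algebra.algebraMap_eq_smul_one, mul_smul_comm, mul_one]
    · ext1 h; ext1 a
      simp [conv_apply _ _ (ℛ k h), coactOp_mul_arg]
  · ext1 h; ext1 a
    simp [scalarOp]
  · ext1 h; ext1 a
    simp [conv_apply _ _ (ℛ k h), coactOp_arg_mul]

/-- The Yetter-Drinfel'd module `H_χ = (H, •_χ, Δ)`, as a `D(H)`-module. -/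
def RadfordModule (χ : H →ₐ[k] k) : Type _ := let _ := χ; H

namespace RadfordModule

variable (χ : H →ₐ[k] k)

noncomputable instance : AddCommGroup (RadfordModule χ) := inferInstanceAs (AddCommGroup H)

/-- The identification of `H_χ` with `H` as additive groups. -/
def equiv : RadfordModule χ ≃+ H := AddEquiv.refl H

/-- The representation of `D(H)` on `H` given by `(p ⊗ h) · a = p · (h •_χ a)`. -/
noncomputable def rep : DrinfeldDouble k H →+* Module.End k H where
  toFun d := liftOp coactOp (bullet χ) (DrinfeldDouble.equiv k H d)
  map_one' := by
    change coactOp counit * bullet χ 1 = 1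
    rw [coactOp_counit, bullet_one, mul_one]
  map_mul' d e := liftOp_mul coactOp (bullet χ) (bullet_mul χ) coactOp_mul (bullet_compat χ) d e
  map_zero' := map_zero (liftOp coactOp (bullet χ))
  map_add' d e := map_add (liftOp coactOp (bullet χ)) d e

noncomputable instance : Module (DrinfeldDouble k H) (RadfordModule χ) where
  smul d m := (equiv χ).symm (rep χ d (equiv χ m))
  one_smul m := LinearMap.congr_fun (map_one (rep χ)) m
  mul_smul d e m := LinearMap.congr_fun (map_mul (rep χ) d e) m
  smul_zero d := map_zero (rep χ d)
  smul_add d m n := map_add (rep χ d) m n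
  add_smul d e m := LinearMap.congr_fun (map_add (rep χ) d e) m
  zero_smul m := LinearMap.congr_fun (map_zero (rep χ)) m

/-- The action of `p ⊗ h ∈ D(H)` on `H_χ`. -/
theorem tmul_smul (p : Module.Dual k H) (h : H) (m : RadfordModule χ) :
    (DrinfeldDouble.equiv k H).symm (p ⊗ₜ[k] h) • m =
      (equiv χ).symm (coactOp p (bullet χ h (equiv χ m))) := rfl

end RadfordModule

/-- The submodule `H_{χ,g} = H •_χ g = {h •_χ g | h ∈ H}` of `H_χ`, for a group-like element `g`
of `H` and a group-like element `χ` of `H*` (that is, an algebra homomorphism `χ : H → k`). -/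
noncomputable def radfordSubmodule (χ : H →ₐ[k] k) (g : GroupLike k H) :
    Submodule (DrinfeldDouble k H) (RadfordModule χ) where
  carrier := {m | ∃ h : H, m = (RadfordModule.equiv χ).symm (bullet χ h g.val)}
  zero_mem' := ⟨0, by simp⟩
  add_mem' := by
    rintro _ _ ⟨a, rfl⟩ ⟨b, rfl⟩
    exact ⟨a + b, by simp⟩
  smul_mem' := by
    rintro d _ ⟨b, rfl⟩
    suffices key : ∀ d : Module.Dual k H ⊗[k] H,
        liftOp coactOp (bullet χ) d (bullet χ b g.val) ∈
          LinearMap.range ((bullet χ).flip g.val) by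
      obtain ⟨h, hh⟩ := key (DrinfeldDouble.equiv k H d)
      exact ⟨h, hh.symm⟩
    intro d
    induction d with
    | zero => simp
    | add d₁ d₂ h₁ h₂ => rw [map_add]; exact Submodule.add_mem _ h₁ h₂
    | tmul p h =>
      have hg : ∀ q : Module.Dual k H, coactOp q g.val = q g.val • g.val := by
        intro q
        change TensorProduct.rid k H (LinearMap.lTensor H q (comul g.val)) = _
        rw [g.2.comul_eq_tmul_self]
        simp
      have e : liftOp coactOp (bullet χ) (p ⊗ₜ[k] h) (bullet χ b g.val) =
          (coactOp p * bullet χ (h * b)) g.val := by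
        rw [liftOp_tmul, bullet_mul]
        rfl
      rw [e, ← cross_relation' (bullet χ) coactOp (bullet_compat χ) (ℛ k (h * b))
        (fun i => ℛ k ((ℛ k (h * b)).right i)) p]
      simp only [LinearMap.sum_apply, Module.End.mul_apply, hg, map_smul]
      refine Submodule.sum_mem _ fun i _ => Submodule.sum_mem _ fun j _ =>
        Submodule.smul_mem _ _ ⟨_, rfl⟩

end Radford

/-! ### A `q`-binomial computation -/

section QBinomial

variable {k : Type*} [Field k]

/-- Gaussian binomial coefficients, by the `q`-Pascal rule. -/
def gauss (q : k) : ℕ → ℕ → k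
  | _, 0 => 1
  | 0, _ + 1 => 0
  | m + 1, j + 1 => gauss q m j + q ^ (j + 1) * gauss q m (j + 1)

theorem gauss_zero_right (q : k) (m : ℕ) : gauss q m 0 = 1 := by cases m <;> rfl

theorem gauss_of_lt (q : k) (m : ℕ) : ∀ j, m < j → gauss q m j = 0 := by
  induction m with
  | zero => intro j hj; cases j with
    | zero => omega
    | succ j => rfl
  | succ m ih => intro j hj; cases j with
    | zero => omega
    | succ j => simp [gauss, ih j (by omega), ih (j + 1) (by omega)]

theorem gauss_self (q : k) (m : ℕ) : gauss q m m = 1 := by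
  induction m with
  | zero => rfl
  | succ m ih => simp [gauss, ih, gauss_of_lt q m (m + 1) (by omega)]

theorem gauss_mul (q : k) : ∀ m i j, i + j = m →
    gauss q m j * (∏ s ∈ Finset.range i, (1 - q ^ (s + 1))) *
      (∏ s ∈ Finset.range j, (1 - q ^ (s + 1))) = ∏ s ∈ Finset.range m, (1 - q ^ (s + 1)) := by
  intro m
  induction m with
  | zero =>
    intro i j h
    obtain ⟨rfl, rfl⟩ : i = 0 ∧ j = 0 := by omega
    simp [gauss]
  | succ m ih =>
    intro i j h
    rcases j with _ | j
    · obtain rfl : i = m + 1 := by omega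
      simp [gauss]
    rcases i with _ | i
    · obtain rfl : j = m := by omega
      simp [gauss_self]
    · obtain rfl : m = i + 1 + j := by omega
      have h₁ := ih (i + 1) j (by omega)
      have h₂ := ih i (j + 1) (by omega)
      rw [Finset.prod_range_succ _ (i + 1 + j), gauss]
      rw [Finset.prod_range_succ _ i] at h₁ ⊢
      rw [Finset.prod_range_succ _ j] at h₂ ⊢
      linear_combination (1 - q ^ (j + 1)) * h₁ + q ^ (j + 1) * (1 - q ^ (i + 1)) * h₂

theorem gauss_eq_zero {q : k} {m : ℕ} (hq : IsPrimitiveRoot q m) (j : ℕ) (h₀ : 0 < j)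
    (h₁ : j < m) : gauss q m j = 0 := by
  have h := gauss_mul q m (m - j) j (by omega)
  have hne : ∀ i, i < m → ∏ s ∈ Finset.range i, (1 - q ^ (s + 1)) ≠ 0 := by
    intro i hi
    rw [Finset.prod_ne_zero_iff]
    intro s hs
    rw [Finset.mem_range] at hs
    exact sub_ne_zero.mpr (hq.pow_ne_one_of_pos_of_lt (by omega) (by omega)).symm
  have h0 : ∏ s ∈ Finset.range m, (1 - q ^ (s + 1)) = 0 := by
    refine Finset.prod_eq_zero (Finset.mem_range.mpr (show m - 1 < m by omega)) ?_
    rw [Nat.sub_add_cancel (by omega), hq.pow_eq_one, sub_self]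
  rw [h0, mul_assoc] at h
  exact (mul_eq_zero.mp h).resolve_right
    (mul_ne_zero (hne _ (by omega)) (hne _ h₁))

variable {R : Type*} [Ring R] [Algebra k R]

theorem q_comm_pow {q : k} {u v : R} (h : v * u = q • (u * v)) (j : ℕ) :
    v * u ^ j = q ^ j • (u ^ j * v) := by
  induction j with
  | zero => simp
  | succ j ih =>
    rw [pow_succ, ← mul_assoc, ih, smul_mul_assoc, mul_assoc, h, mul_smul_comm, smul_smul,
      ← mul_assoc, ← pow_succ]

theorem q_binomial {q : k} {u v : R} (h : v * u = q • (u * v)) (m : ℕ) :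
    (u + v) ^ m = ∑ j ∈ Finset.range (m + 1), gauss q m j • (u ^ j * v ^ (m - j)) := by
  induction m with
  | zero => simp [gauss]
  | succ m ih =>
    rw [pow_succ', ih, add_mul, Finset.sum_range_succ' _ (m + 1)]
    have e₁ : v * ∑ j ∈ Finset.range (m + 1), gauss q m j • (u ^ j * v ^ (m - j)) =
        ∑ j ∈ Finset.range (m + 1), (q ^ (j + 1) * gauss q m (j + 1)) •
          (u ^ (j + 1) * v ^ (m - j)) + v ^ (m + 1) := by
      rw [Finset.sum_range_succ (fun j => (q ^ (j + 1) * gauss q m (j + 1)) •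
          (u ^ (j + 1) * v ^ (m - j))), gauss_of_lt q m (m + 1) (by omega), mul_zero, zero_smul,
        add_zero, Finset.sum_range_succ', mul_add, Finset.mul_sum]
      congr 1
      · refine Finset.sum_congr rfl fun j hj => ?_
        rw [Finset.mem_range] at hj
        rw [mul_smul_comm, ← mul_assoc, q_comm_pow h, smul_mul_assoc, smul_smul, mul_assoc,
          ← pow_succ', mul_comm (gauss q m (j + 1)), show m - (j + 1) + 1 = m - j by omega]
      · simp [gauss_zero_right, pow_succ']
    rw [e₁, Finset.mul_sum, ← add_assoc, ← Finset.sum_add_distrib]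
    simp [gauss, add_smul, pow_succ', mul_assoc]

theorem q_binomial_eq_zero {q : k} {m : ℕ} (hm : m ≠ 0) (hq : IsPrimitiveRoot q m) {u v : R}
    (h : v * u = q • (u * v)) (hu : u ^ m = 0) (hv : v ^ m = 0) : (u + v) ^ m = 0 := by
  rw [q_binomial h]
  refine Finset.sum_eq_zero fun j hj => ?_
  rw [Finset.mem_range] at hj
  rcases Nat.eq_zero_or_pos j with rfl | h₀
  · simp [hv]
  · rcases Nat.lt_or_ge j m with h₁ | h₁
    · simp [gauss_eq_zero hq j h₀ h₁]
    · obtain rfl : j = m := by omega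
      simp [hu]

theorem q_mul_pow {c : k} {u v : R} (h : v * u = c • (u * v)) (m : ℕ) :
    ∃ d : k, (u * v) ^ m = d • (u ^ m * v ^ m) := by
  induction m with
  | zero => exact ⟨1, by simp⟩
  | succ m ih =>
    obtain ⟨d, hd⟩ := ih
    refine ⟨c ^ m * d, ?_⟩
    rw [pow_succ', hd, mul_smul_comm, mul_assoc u v, ← mul_assoc v, q_comm_pow h, smul_mul_assoc,
      mul_smul_comm, smul_smul, mul_comm d, mul_assoc, ← pow_succ', ← mul_assoc, ← pow_succ']

end QBinomial

/-! ### The `n`-rank Taft algebra -/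

/-- The generators `K(ε_i)`, `K(ε_i)⁻¹` and `x_i`, `1 ≤ i ≤ n`. -/
inductive TaftGen (n : ℕ) : Type
  | K (i : Fin n)
  | Kinv (i : Fin n)
  | x (i : Fin n)

/-- The values `θ(ε_i, ε_j)` of the skew bicharacter: `q` if `i > j`, `1` if `i = j` and `q⁻¹` if
`i < j`. -/
def theta {k : Type*} [Field k] {n : ℕ} (q : k) (i j : Fin n) : k :=
  if j < i then q else if i = j then 1 else q⁻¹

open TaftGen FreeAlgebra in
/-- The defining relations of the `n`-rank Taft algebra: the relations of the quantized enveloping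
algebra `A_q(n)` together with `x_i ^ ℓ = 0`. -/
inductive TaftRel (k : Type*) [Field k] (n ℓ : ℕ) (q : k) :
    FreeAlgebra k (TaftGen n) → FreeAlgebra k (TaftGen n) → Prop
  | K_comm (i j : Fin n) : TaftRel k n ℓ q (ι k (K i) * ι k (K j)) (ι k (K j) * ι k (K i))
  | K_Kinv (i : Fin n) : TaftRel k n ℓ q (ι k (K i) * ι k (Kinv i)) 1
  | Kinv_K (i : Fin n) : TaftRel k n ℓ q (ι k (Kinv i) * ι k (K i)) 1
  | K_pow (i : Fin n) : TaftRel k n ℓ q (ι k (K i) ^ ℓ) 1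
  | K_x (i j : Fin n) : TaftRel k n ℓ q (ι k (K i) * ι k (x j) * ι k (Kinv i))
      ((theta q i j * (if i = j then q else 1)) • ι k (x j))
  | x_x (i j : Fin n) : TaftRel k n ℓ q (ι k (x i) * ι k (x j))
      (theta q i j • (ι k (x j) * ι k (x i)))
  | x_pow (i : Fin n) : TaftRel k n ℓ q (ι k (x i) ^ ℓ) 0

/-- The `n`-rank Taft algebra `Ā_q(n)` over `k`, where `q` is a primitive `ℓ`-th root of unity. -/
def TaftAlgebra (k : Type*) [Field k] (n ℓ : ℕ) (q : k) : Type _ :=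
  RingQuot (TaftRel k n ℓ q)

namespace TaftAlgebra

section

variable {k : Type*} [Field k] {n ℓ : ℕ} {q : k}

noncomputable instance : Ring (TaftAlgebra k n ℓ q) :=
  inferInstanceAs (Ring (RingQuot (TaftRel k n ℓ q)))

noncomputable instance : Algebra k (TaftAlgebra k n ℓ q) :=
  inferInstanceAs (Algebra k (RingQuot (TaftRel k n ℓ q)))

/-- The canonical projection from the free algebra. -/
noncomputable def mk (k : Type*) [Field k] (n ℓ : ℕ) (q : k) :
    FreeAlgebra k (TaftGen n) →ₐ[k] TaftAlgebra k n ℓ q :=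
  RingQuot.mkAlgHom k (TaftRel k n ℓ q)

/-- The image of a generator. -/
noncomputable def gen (g : TaftGen n) : TaftAlgebra k n ℓ q := mk k n ℓ q (FreeAlgebra.ι k g)

/-- The element `K(ε_i)`. -/
noncomputable def K (i : Fin n) : TaftAlgebra k n ℓ q := gen (.K i)

/-- The element `K(ε_i)⁻¹`. -/
noncomputable def Kinv (i : Fin n) : TaftAlgebra k n ℓ q := gen (.Kinv i)

/-- The element `x_i`. -/
noncomputable def x (i : Fin n) : TaftAlgebra k n ℓ q := gen (.x i)

theorem mk_rel {a b : FreeAlgebra k (TaftGen n)} (h : TaftRel k n ℓ q a b) :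
    mk k n ℓ q a = mk k n ℓ q b :=
  RingQuot.mkAlgHom_rel k h

theorem K_comm (i j : Fin n) : (K i * K j : TaftAlgebra k n ℓ q) = K j * K i := by
  simpa [K, gen] using mk_rel (TaftRel.K_comm (k := k) (ℓ := ℓ) (q := q) i j)

theorem K_Kinv (i : Fin n) : (K i * Kinv i : TaftAlgebra k n ℓ q) = 1 := by
  simpa [K, Kinv, gen] using mk_rel (TaftRel.K_Kinv (k := k) (ℓ := ℓ) (q := q) i)

theorem Kinv_K (i : Fin n) : (Kinv i * K i : TaftAlgebra k n ℓ q) = 1 := by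
  simpa [K, Kinv, gen] using mk_rel (TaftRel.Kinv_K (k := k) (ℓ := ℓ) (q := q) i)

theorem K_pow (i : Fin n) : (K i ^ ℓ : TaftAlgebra k n ℓ q) = 1 := by
  simpa [K, gen] using mk_rel (TaftRel.K_pow (k := k) (ℓ := ℓ) (q := q) i)

theorem K_x_Kinv (i j : Fin n) : (K i * x j * Kinv i : TaftAlgebra k n ℓ q) =
    (theta q i j * (if i = j then q else 1)) • x j := by
  have h := mk_rel (TaftRel.K_x (k := k) (ℓ := ℓ) (q := q) i j)
  rwa [map_mul, map_mul, map_smul] at h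

theorem x_x (i j : Fin n) : (x i * x j : TaftAlgebra k n ℓ q) = theta q i j • (x j * x i) := by
  simpa [x, gen] using mk_rel (TaftRel.x_x (k := k) (ℓ := ℓ) (q := q) i j)

theorem x_pow (i : Fin n) : (x i ^ ℓ : TaftAlgebra k n ℓ q) = 0 := by
  simpa [x, gen] using mk_rel (TaftRel.x_pow (k := k) (ℓ := ℓ) (q := q) i)

theorem K_x (i j : Fin n) : (K i * x j : TaftAlgebra k n ℓ q) =
    (theta q i j * (if i = j then q else 1)) • (x j * K i) := by
  rw [← smul_mul_assoc, ← K_x_Kinv, mul_assoc, Kinv_K, mul_one]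

theorem x_Kinv (i j : Fin n) : (x j * Kinv i : TaftAlgebra k n ℓ q) =
    (theta q i j * (if i = j then q else 1)) • (Kinv i * x j) := by
  rw [← mul_smul_comm, ← K_x_Kinv, ← mul_assoc, ← mul_assoc, Kinv_K, one_mul]

theorem Kinv_comm (i j : Fin n) : (Kinv i * Kinv j : TaftAlgebra k n ℓ q) = Kinv j * Kinv i := by
  let u : Fin n → (TaftAlgebra k n ℓ q)ˣ := fun i => ⟨K i, Kinv i, K_Kinv i, Kinv_K i⟩
  have h : u j * u i = u i * u j := Units.ext (K_comm j i)
  have := congrArg (fun w => ((w⁻¹ : (TaftAlgebra k n ℓ q)ˣ) : TaftAlgebra k n ℓ q)) h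
  simpa [mul_inv_rev, u] using this

theorem Kinv_pow (i : Fin n) : (Kinv i ^ ℓ : TaftAlgebra k n ℓ q) = 1 := by
  have h : Commute (Kinv i : TaftAlgebra k n ℓ q) (K i) := by
    rw [Commute, SemiconjBy, K_Kinv, Kinv_K]
  have h' := h.mul_pow ℓ
  rw [Kinv_K, one_pow, K_pow, mul_one] at h'
  exact h'.symm

/-- The universal property of the presentation. -/
noncomputable def lift {B : Type*} [Semiring B] [Algebra k B] (f : TaftGen n → B)
    (hf : ∀ ⦃a b⦄, TaftRel k n ℓ q a b → FreeAlgebra.lift k f a = FreeAlgebra.lift k f b) :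
    TaftAlgebra k n ℓ q →ₐ[k] B :=
  RingQuot.liftAlgHom k ⟨FreeAlgebra.lift k f, hf⟩

theorem lift_gen {B : Type*} [Semiring B] [Algebra k B] (f : TaftGen n → B)
    (hf : ∀ ⦃a b⦄, TaftRel k n ℓ q a b → FreeAlgebra.lift k f a = FreeAlgebra.lift k f b)
    (g : TaftGen n) : lift (ℓ := ℓ) (q := q) f hf (gen g) = f g := by
  rw [lift, gen, mk]
  exact (RingQuot.liftAlgHom_mkAlgHom_apply k _ _ _).trans (FreeAlgebra.lift_ι_apply f g)

theorem algHom_ext {B : Type*} [Semiring B] [Algebra k B] {f g : TaftAlgebra k n ℓ q →ₐ[k] B}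
    (hK : ∀ i, f (K i) = g (K i)) (hKinv : ∀ i, f (Kinv i) = g (Kinv i))
    (hx : ∀ i, f (x i) = g (x i)) : f = g := by
  refine RingQuot.ringQuot_ext' k _ _ (FreeAlgebra.hom_ext (funext fun a => ?_))
  cases a with
  | K i => exact hK i
  | Kinv i => exact hKinv i
  | x i => exact hx i

theorem gen_induction {P : TaftAlgebra k n ℓ q → Prop} (hK : ∀ i, P (K i))
    (hKinv : ∀ i, P (Kinv i)) (hx : ∀ i, P (x i)) (hs : ∀ c : k, P (algebraMap k _ c))
    (hadd : ∀ a b, P a → P b → P (a + b)) (hmul : ∀ a b, P a → P b → P (a * b))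
    (a : TaftAlgebra k n ℓ q) : P a := by
  obtain ⟨a, rfl⟩ := RingQuot.mkAlgHom_surjective k (TaftRel k n ℓ q) a
  induction a using FreeAlgebra.induction with
  | grade0 c => rw [AlgHom.commutes]; exact hs c
  | grade1 g =>
    cases g with
    | K i => exact hK i
    | Kinv i => exact hKinv i
    | x i => exact hx i
  | mul a b ha hb => rw [map_mul]; exact hmul _ _ ha hb
  | add a b ha hb => rw [map_add]; exact hadd _ _ ha hb

variable [NeZero ℓ] [hq : Fact (IsPrimitiveRoot q ℓ)]

theorem q_ne_zero (hq : IsPrimitiveRoot q ℓ) : q ≠ 0 := hq.ne_zero (NeZero.ne ℓ)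

theorem theta_mul_theta (hq : IsPrimitiveRoot q ℓ) (i j : Fin n) :
    theta q i j * theta q j i = 1 := by
  have h0 : q ≠ 0 := q_ne_zero hq
  rcases lt_trichotomy i j with h | rfl | h
  · simp [theta, h, h.not_gt, h.ne, h0]
  · simp [theta]
  · simp [theta, h, h.not_gt, h.ne, h0]

theorem theta_self (i : Fin n) : theta q i i = 1 := by simp [theta]

/-- The coproduct on generators: `Δ(K(ε_i)^±) = K(ε_i)^± ⊗ K(ε_i)^±` and
`Δ(x_i) = x_i ⊗ 1 + K(ε_i) ⊗ x_i`. -/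
noncomputable def comulGen :
    TaftGen n → TaftAlgebra k n ℓ q ⊗[k] TaftAlgebra k n ℓ q
  | .K i => K i ⊗ₜ K i
  | .Kinv i => Kinv i ⊗ₜ Kinv i
  | .x i => x i ⊗ₜ 1 + K i ⊗ₜ x i

/-- The coproduct. -/
noncomputable def comulHom : TaftAlgebra k n ℓ q →ₐ[k]
    TaftAlgebra k n ℓ q ⊗[k] TaftAlgebra k n ℓ q :=
  lift comulGen (by
    intro a b h
    cases h with
    | K_comm i j => simp [comulGen, K_comm i j]
    | K_Kinv i => simp [comulGen, K_Kinv, Algebra.TensorProduct.one_def]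
    | Kinv_K i => simp [comulGen, Kinv_K, Algebra.TensorProduct.one_def]
    | K_pow i => simp [comulGen, K_pow, Algebra.TensorProduct.one_def, Algebra.TensorProduct.tmul_pow]
    | K_x i j =>
      simp only [map_mul, map_smul, FreeAlgebra.lift_ι_apply, comulGen, mul_add, add_mul,
        Algebra.TensorProduct.tmul_mul_tmul, K_x_Kinv, mul_one, K_Kinv, smul_add]
      rw [K_comm i j, mul_assoc, K_Kinv, mul_one, TensorProduct.smul_tmul', TensorProduct.tmul_smul]
    | x_x i j =>
      simp only [map_mul, map_smul, FreeAlgebra.lift_ι_apply, comulGen, mul_add, add_mul,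
        Algebra.TensorProduct.tmul_mul_tmul, mul_one, one_mul, smul_add]
      by_cases hij : i = j
      · subst hij
        simp [theta_self]
      · have e := theta_mul_theta hq.out i j
        rw [x_x i j, K_comm i j, K_x i j, K_x j i, if_neg hij, if_neg (Ne.symm hij)]
        simp only [mul_one, TensorProduct.smul_tmul', TensorProduct.tmul_smul, smul_smul, e,
          one_smul]
        abel
    | x_pow i =>
      simp only [map_pow, map_zero, FreeAlgebra.lift_ι_apply, comulGen]
      refine q_binomial_eq_zero (NeZero.ne ℓ) hq.out ?_ ?_ ?_
      · simp [K_x, theta_self, TensorProduct.smul_tmul']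
      · simp [Algebra.TensorProduct.tmul_pow, x_pow]
      · simp [Algebra.TensorProduct.tmul_pow, x_pow])

/-- The counit on generators. -/
def counitGen (k : Type*) [Field k] {n : ℕ} : TaftGen n → k
  | .K _ => 1
  | .Kinv _ => 1
  | .x _ => 0

/-- The counit: `ε(K(ε_i)^±) = 1` and `ε(x_i) = 0`. -/
noncomputable def counitHom : TaftAlgebra k n ℓ q →ₐ[k] k :=
  lift (counitGen k) (by
    intro a b h
    cases h <;> simp only [map_mul, map_smul, map_pow, map_one, map_zero,
      FreeAlgebra.lift_ι_apply] <;> simp [counitGen, NeZero.ne ℓ])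

/-- The antipode on generators: `s(K(ε_i)^±) = K(ε_i)^∓` and `s(x_i) = -K(ε_i)⁻¹ x_i`. -/
noncomputable def antipodeGen : TaftGen n → (TaftAlgebra k n ℓ q)ᵐᵒᵖ
  | .K i => .op (Kinv i)
  | .Kinv i => .op (K i)
  | .x i => .op (-(Kinv i * x i))

/-- The antipode, as an algebra homomorphism to the opposite algebra. -/
noncomputable def antipodeHom : TaftAlgebra k n ℓ q →ₐ[k] (TaftAlgebra k n ℓ q)ᵐᵒᵖ :=
  lift antipodeGen (by
    intro a b h
    cases h with
    | K_comm i j => simp [antipodeGen, ← MulOpposite.op_mul, Kinv_comm i j]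
    | K_Kinv i => simp [antipodeGen, ← MulOpposite.op_mul, K_Kinv]
    | Kinv_K i => simp [antipodeGen, ← MulOpposite.op_mul, Kinv_K]
    | K_pow i => simp [antipodeGen, ← MulOpposite.op_pow, Kinv_pow]
    | K_x i j =>
      simp only [map_mul, map_smul, FreeAlgebra.lift_ι_apply, antipodeGen, ← MulOpposite.op_mul,
        ← MulOpposite.op_smul]
      congr 1
      simp only [neg_mul, mul_neg, smul_neg]
      congr 1
      rw [mul_assoc, x_Kinv, mul_smul_comm, mul_smul_comm, ← mul_assoc (Kinv j), Kinv_comm j i,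
        ← mul_assoc (K i), ← mul_assoc (K i), K_Kinv, one_mul]
    | x_x i j =>
      simp only [map_mul, map_smul, FreeAlgebra.lift_ι_apply, antipodeGen, ← MulOpposite.op_mul,
        ← MulOpposite.op_smul]
      congr 1
      simp only [neg_mul, mul_neg, neg_neg]
      by_cases hij : i = j
      · subst hij
        simp [theta_self]
      · have e := theta_mul_theta hq.out i j
        rw [mul_assoc, ← mul_assoc (x j), x_Kinv i j, mul_assoc (Kinv i), ← mul_assoc (x i),
          x_Kinv j i, if_neg hij, if_neg (Ne.symm hij), mul_one, mul_one]
        simp only [smul_mul_assoc, mul_smul_comm, smul_smul, e, one_smul]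
        rw [mul_assoc, mul_assoc, x_x i j]
        simp only [mul_smul_comm]
        rw [← mul_assoc (Kinv j), ← mul_assoc (Kinv i), Kinv_comm i j]
    | x_pow i =>
      simp only [map_pow, map_zero, FreeAlgebra.lift_ι_apply, antipodeGen, ← MulOpposite.op_pow]
      obtain ⟨d, hd⟩ := q_mul_pow (x_Kinv (k := k) (ℓ := ℓ) (q := q) i i) ℓ
      rw [neg_pow, hd, x_pow]
      simp)

theorem comulHom_K (i : Fin n) : comulHom (K i : TaftAlgebra k n ℓ q) = K i ⊗ₜ[k] K i :=
  lift_gen _ _ _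

theorem comulHom_Kinv (i : Fin n) :
    comulHom (Kinv i : TaftAlgebra k n ℓ q) = Kinv i ⊗ₜ[k] Kinv i :=
  lift_gen _ _ _

theorem comulHom_x (i : Fin n) :
    comulHom (x i : TaftAlgebra k n ℓ q) = x i ⊗ₜ[k] 1 + K i ⊗ₜ[k] x i :=
  lift_gen _ _ _

theorem counitHom_K (i : Fin n) : counitHom (K i : TaftAlgebra k n ℓ q) = 1 := lift_gen _ _ _

theorem counitHom_Kinv (i : Fin n) : counitHom (Kinv i : TaftAlgebra k n ℓ q) = 1 :=
  lift_gen _ _ _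

theorem counitHom_x (i : Fin n) : counitHom (x i : TaftAlgebra k n ℓ q) = 0 := lift_gen _ _ _

noncomputable instance : Bialgebra k (TaftAlgebra k n ℓ q) :=
  Bialgebra.ofAlgHom comulHom counitHom
    (by
      refine algHom_ext (fun i => ?_) (fun i => ?_) (fun i => ?_)
      · simp [comulHom_K]
      · simp [comulHom_Kinv]
      · simp [comulHom_x, comulHom_K, TensorProduct.add_tmul, TensorProduct.tmul_add, add_assoc,
          Algebra.TensorProduct.one_def])
    (by
      refine algHom_ext (fun i => ?_) (fun i => ?_) (fun i => ?_)
      · simp [comulHom_K, counitHom_K]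
      · simp [comulHom_Kinv, counitHom_Kinv]
      · simp [comulHom_x, counitHom_K, counitHom_x])
    (by
      refine algHom_ext (fun i => ?_) (fun i => ?_) (fun i => ?_)
      · simp [comulHom_K, counitHom_K]
      · simp [comulHom_Kinv, counitHom_Kinv]
      · simp [comulHom_x, counitHom_x])

theorem comul_eq (a : TaftAlgebra k n ℓ q) : comul (R := k) a = comulHom a := rfl

theorem counit_eq (a : TaftAlgebra k n ℓ q) : counit (R := k) a = counitHom a := rfl

/-- The antipode. -/
noncomputable def antipodeLin : TaftAlgebra k n ℓ q →ₗ[k] TaftAlgebra k n ℓ q :=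
  (MulOpposite.opLinearEquiv k).symm.toLinearMap ∘ₗ antipodeHom.toLinearMap

theorem antipodeLin_K (i : Fin n) : antipodeLin (K i : TaftAlgebra k n ℓ q) = Kinv i :=
  congrArg MulOpposite.unop (lift_gen (q := q) (ℓ := ℓ) antipodeGen _ (.K i))

theorem antipodeLin_Kinv (i : Fin n) : antipodeLin (Kinv i : TaftAlgebra k n ℓ q) = K i :=
  congrArg MulOpposite.unop (lift_gen (q := q) (ℓ := ℓ) antipodeGen _ (.Kinv i))

theorem antipodeLin_x (i : Fin n) : antipodeLin (x i : TaftAlgebra k n ℓ q) = -(Kinv i * x i) :=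
  congrArg MulOpposite.unop (lift_gen (q := q) (ℓ := ℓ) antipodeGen _ (.x i))

theorem antipodeLin_mul (a b : TaftAlgebra k n ℓ q) :
    antipodeLin (a * b) = antipodeLin b * antipodeLin a := by
  simp [antipodeLin]

theorem antipodeLin_algebraMap (c : k) :
    antipodeLin (algebraMap k (TaftAlgebra k n ℓ q) c) = algebraMap k _ c := by
  simp [antipodeLin]

theorem antipode_axiom_left (a : TaftAlgebra k n ℓ q) :
    LinearMap.mul' k _ (antipodeLin.rTensor _ (comul (R := k) a)) =
      algebraMap k _ (counit (R := k) a) := by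
  have key : ∀ y z : TaftAlgebra k n ℓ q ⊗[k] TaftAlgebra k n ℓ q, ∀ c : k,
      LinearMap.mul' k _ (antipodeLin.rTensor _ y) = algebraMap k _ c →
      LinearMap.mul' k _ (antipodeLin.rTensor _ (y * z)) =
        c • LinearMap.mul' k _ (antipodeLin.rTensor _ z) := by
    intro y z c hy
    have h : ∀ b₁ b₂ : TaftAlgebra k n ℓ q,
        LinearMap.mul' k _ (antipodeLin.rTensor _ (y * (b₁ ⊗ₜ[k] b₂))) =
          antipodeLin b₁ * LinearMap.mul' k _ (antipodeLin.rTensor _ y) * b₂ := by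
      intro b₁ b₂
      clear hy
      induction y with
      | zero => simp
      | add y₁ y₂ h₁ h₂ => simp only [add_mul, mul_add, map_add, h₁, h₂]
      | tmul a₁ a₂ => simp [antipodeLin_mul, mul_assoc]
    induction z with
    | zero => simp
    | add z₁ z₂ h₁ h₂ => simp only [mul_add, map_add, h₁, h₂, smul_add]
    | tmul b₁ b₂ => simp [h, hy, Algebra.algebraMap_eq_smul_one]
  induction a using gen_induction with
  | hK i => simp [comul_eq, counit_eq, comulHom_K, counitHom_K, antipodeLin_K, Kinv_K]
  | hKinv i => simp [comul_eq, counit_eq, comulHom_Kinv, counitHom_Kinv, antipodeLin_Kinv, K_Kinv]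
  | hx i => simp [comul_eq, counit_eq, comulHom_x, counitHom_x, antipodeLin_x, antipodeLin_K]
  | hs c => simp [Algebra.TensorProduct.algebraMap_apply, antipodeLin_algebraMap]
  | hadd a b ha hb => simp only [map_add, ha, hb]
  | hmul a b ha hb =>
    rw [Bialgebra.comul_mul, key _ _ _ ha, hb, Bialgebra.counit_mul, map_mul, Algebra.smul_def]

theorem antipode_axiom_right (a : TaftAlgebra k n ℓ q) :
    LinearMap.mul' k _ (antipodeLin.lTensor _ (comul (R := k) a)) =
      algebraMap k _ (counit (R := k) a) := by
  have key : ∀ y z : TaftAlgebra k n ℓ q ⊗[k] TaftAlgebra k n ℓ q, ∀ c : k,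
      LinearMap.mul' k _ (antipodeLin.lTensor _ z) = algebraMap k _ c →
      LinearMap.mul' k _ (antipodeLin.lTensor _ (y * z)) =
        c • LinearMap.mul' k _ (antipodeLin.lTensor _ y) := by
    intro y z c hz
    have h : ∀ b₁ b₂ : TaftAlgebra k n ℓ q,
        LinearMap.mul' k _ (antipodeLin.lTensor _ ((b₁ ⊗ₜ[k] b₂) * z)) =
          b₁ * LinearMap.mul' k _ (antipodeLin.lTensor _ z) * antipodeLin b₂ := by
      intro b₁ b₂
      clear hz
      induction z with
      | zero => simp
      | add y₁ y₂ h₁ h₂ => simp only [add_mul, mul_add, map_add, h₁, h₂]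
      | tmul a₁ a₂ => simp [antipodeLin_mul, mul_assoc]
    induction y with
    | zero => simp
    | add z₁ z₂ h₁ h₂ => simp only [add_mul, map_add, h₁, h₂, smul_add]
    | tmul b₁ b₂ => simp [h, hz, Algebra.algebraMap_eq_smul_one]
  induction a using gen_induction with
  | hK i => simp [comul_eq, counit_eq, comulHom_K, counitHom_K, antipodeLin_K, K_Kinv]
  | hKinv i => simp [comul_eq, counit_eq, comulHom_Kinv, counitHom_Kinv, antipodeLin_Kinv, Kinv_K]
  | hx i =>
    have h1 : antipodeLin (1 : TaftAlgebra k n ℓ q) = 1 := by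
      simpa using antipodeLin_algebraMap (n := n) (ℓ := ℓ) (q := q) 1
    simp [comul_eq, counit_eq, comulHom_x, counitHom_x, antipodeLin_x, h1, ← mul_assoc, K_Kinv]
  | hs c =>
    have h1 : antipodeLin (1 : TaftAlgebra k n ℓ q) = 1 := by
      simpa using antipodeLin_algebraMap (n := n) (ℓ := ℓ) (q := q) 1
    simp [Algebra.TensorProduct.algebraMap_apply, h1]
  | hadd a b ha hb => simp only [map_add, ha, hb]
  | hmul a b ha hb =>
    rw [Bialgebra.comul_mul, key _ _ _ hb, ha, Bialgebra.counit_mul, mul_comm, map_mul,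
      Algebra.smul_def]

noncomputable instance : HopfAlgebra k (TaftAlgebra k n ℓ q) where
  antipode := antipodeLin
  mul_antipode_rTensor_comul := LinearMap.ext antipode_axiom_left
  mul_antipode_lTensor_comul := LinearMap.ext antipode_axiom_right

/-- The square of the antipode is an algebra homomorphism. -/
noncomputable def antipodeSq : TaftAlgebra k n ℓ q →ₐ[k] TaftAlgebra k n ℓ q :=
  AlgHom.ofLinearMap (antipodeLin ∘ₗ antipodeLin)
    (by simpa using congrArg antipodeLin (antipodeLin_algebraMap (n := n) (ℓ := ℓ) (q := q) 1) |>.trans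
          (antipodeLin_algebraMap 1))
    (fun a b => by simp [antipodeLin_mul])

theorem antipodeSq_apply (a : TaftAlgebra k n ℓ q) :
    antipodeSq a = antipodeLin (antipodeLin a) := rfl

theorem antipodeSq_x (i : Fin n) : antipodeSq (x i : TaftAlgebra k n ℓ q) = q⁻¹ • x i := by
  have h0 : q ≠ 0 := q_ne_zero hq.out
  have h := K_x (k := k) (ℓ := ℓ) (q := q) i i
  rw [theta_self, if_pos rfl, one_mul] at h
  rw [antipodeSq_apply, antipodeLin_x, map_neg, antipodeLin_mul, antipodeLin_x, antipodeLin_Kinv,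
    neg_mul, neg_neg, eq_inv_smul_iff₀ h0, mul_assoc, ← mul_smul_comm]
  rw [← h, ← mul_assoc, Kinv_K, one_mul]

theorem antipodeSq_pow : (antipodeSq : TaftAlgebra k n ℓ q →ₐ[k] TaftAlgebra k n ℓ q) ^ ℓ = 1 := by
  have hK : ∀ (m : ℕ) (i : Fin n),
      (antipodeSq ^ m : TaftAlgebra k n ℓ q →ₐ[k] TaftAlgebra k n ℓ q) (K i) = K i := by
    intro m i
    induction m with
    | zero => rfl
    | succ m ih =>
      rw [pow_succ, AlgHom.mul_apply, antipodeSq_apply, antipodeLin_K, antipodeLin_Kinv, ih]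
  have hKinv : ∀ (m : ℕ) (i : Fin n),
      (antipodeSq ^ m : TaftAlgebra k n ℓ q →ₐ[k] TaftAlgebra k n ℓ q) (Kinv i) = Kinv i := by
    intro m i
    induction m with
    | zero => rfl
    | succ m ih =>
      rw [pow_succ, AlgHom.mul_apply, antipodeSq_apply, antipodeLin_Kinv, antipodeLin_K, ih]
  have hx : ∀ (m : ℕ) (i : Fin n),
      (antipodeSq ^ m : TaftAlgebra k n ℓ q →ₐ[k] TaftAlgebra k n ℓ q) (x i) =
        q⁻¹ ^ m • x i := by
    intro m i
    induction m with
    | zero => rw [pow_zero, pow_zero, one_smul]; rfl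
    | succ m ih => rw [pow_succ, AlgHom.mul_apply, antipodeSq_x, map_smul, ih, smul_smul, pow_succ']
  refine algHom_ext (hK ℓ) (hKinv ℓ) fun i => ?_
  rw [hx, inv_pow, hq.out.pow_eq_one, inv_one, one_smul]
  rfl

instance : BijectiveAntipode k (TaftAlgebra k n ℓ q) where
  bijective := by
    have hu : IsUnit (antipodeSq : TaftAlgebra k n ℓ q →ₐ[k] TaftAlgebra k n ℓ q) :=
      IsUnit.of_pow_eq_one antipodeSq_pow (NeZero.ne ℓ)
    obtain ⟨u, hu⟩ := hu
    have h₁ : ∀ a : TaftAlgebra k n ℓ q, antipodeLin (antipodeLin (u⁻¹.val a)) = a := by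
      intro a
      rw [← antipodeSq_apply, ← hu, ← AlgHom.mul_apply, Units.mul_inv]
      rfl
    have h₂ : ∀ a : TaftAlgebra k n ℓ q, u⁻¹.val (antipodeLin (antipodeLin a)) = a := by
      intro a
      rw [← antipodeSq_apply, ← hu, ← AlgHom.mul_apply, Units.inv_mul]
      rfl
    constructor
    · intro a b hab
      rw [← h₂ a, ← h₂ b]
      exact congrArg (fun c => u⁻¹.val (antipodeLin c)) hab
    · intro a
      exact ⟨_, h₁ a⟩

theorem isGroupLikeElem_K (i : Fin n) : IsGroupLikeElem k (K i : TaftAlgebra k n ℓ q) where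
  counit_eq_one := counitHom_K i
  comul_eq_tmul_self := comulHom_K i

end

/-- The algebra homomorphism `𝒦(α) : Ā_q(n) → k` with `K(ε_i)^± ↦ q^{± α_i}` and `x_i ↦ 0`; on the
basis, `𝒦(α)(x^γ K(β)) = δ_{γ,0} q^{⟨α,β⟩}`. -/
noncomputable def calK (k : Type*) [Field k] {n : ℕ} (ℓ : ℕ) (q : k) [NeZero ℓ]
    [hq : Fact (IsPrimitiveRoot q ℓ)] (α : Fin n → ℕ) : TaftAlgebra k n ℓ q →ₐ[k] k :=
  lift (fun
    | .K i => q ^ α i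
    | .Kinv i => (q ^ α i)⁻¹
    | .x _ => 0) (by
    have h0 : ∀ m : ℕ, q ^ m ≠ 0 := fun m => pow_ne_zero m (q_ne_zero hq.out)
    intro a b h
    cases h with
    | K_comm i j => simp [mul_comm]
    | K_Kinv i => simp [h0]
    | Kinv_K i => simp [h0]
    | K_pow i => simp [pow_right_comm q, hq.out.pow_eq_one]
    | K_x i j => simp only [map_mul, map_smul, FreeAlgebra.lift_ι_apply]; simp
    | x_x i j => simp
    | x_pow i => simp [NeZero.ne ℓ])

/-- The group-like element `K(β) = K(ε_1)^{β_1} ⋯ K(ε_n)^{β_n}`. -/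
noncomputable def groupK (k : Type*) [Field k] {n : ℕ} (ℓ : ℕ) (q : k) [NeZero ℓ]
    [Fact (IsPrimitiveRoot q ℓ)] (β : Fin n → ℕ) : GroupLike k (TaftAlgebra k n ℓ q) :=
  (List.ofFn fun i => (⟨K i, isGroupLikeElem_K i⟩ : GroupLike k (TaftAlgebra k n ℓ q)) ^ β i).prod

/-- The `D(Ā_q(n))`-module `Ā_{α,β} = (Ā_q(n))_{𝒦(α),K(β)} = Ā_q(n) •_{𝒦(α)} K(β)`. -/
noncomputable abbrev Abar (k : Type*) [Field k] {n : ℕ} (ℓ : ℕ) (q : k) [NeZero ℓ]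
    [Fact (IsPrimitiveRoot q ℓ)] (α β : Fin n → ℕ) :
    Submodule (DrinfeldDouble k (TaftAlgebra k n ℓ q)) (RadfordModule (calK k ℓ q α)) :=
  radfordSubmodule (calK k ℓ q α) (groupK k ℓ q β)

end TaftAlgebra

/-- The multi-index `κ = (ℓ - 1, …, ℓ - 1)`. -/
def kappa (n ℓ : ℕ) : Fin n → ℕ := fun _ => ℓ - 1

end TaftDouble

/-!
Write `H = Ā_q(n)`. The argument rests on three facts about Radford's modules; no basis of `H` is
needed.

*Pointedness.* The filtration of `H` by the degree in the `x_i` is a coalgebra filtration whose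
piece of degree `0` is the span of the group-like elements `K(β)`, and functionals that vanish on
this span lower the degree (`coactOp_mem_xFiltration_of_succ`). Together with the linear
independence of group-like elements, this shows that every nonzero `H*`-submodule of `H` contains
some `K(β)` (`exists_coactOp_eq_groupK`).

*Simplicity.* When `χ` kills the `x_i`, each `x_i` maps `H` into the ideal generated by the `x_j`
under `•_χ`, and each `K(ε_i)` scales `K(β)`. Hence the component of degree `0` in the `x_i` of any
element of `H •_χ K(β)` is a multiple of `K(β)` (`degreeZero_bullet_groupK_mem`). A nonzero
submodule of `H •_χ K(β)` contains some `K(β')` by pointedness; this has degree `0`, so that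
`K(β') = K(β)`, which generates (`isSimpleModule_radfordSubmodule`).

*Exhaustion.* A simple `D(H)`-module `M` is finite-dimensional, since `H` is. On the dual of `M` the
transposes of the `x_i` are nilpotent and commute up to scalars, and those of the `K(ε_i)` commute,
so there is a nonzero functional `f` on `M` on which `H` acts through some `𝒦(α)`
(`exists_weight_functional`). By Frobenius reciprocity, `m ↦ ∑ f(m₍₀₎) m₍₁₎` is a nonzero
`D(H)`-homomorphism from `M` to `H_{𝒦(α)}` (`toRadford`). Its image is simple and contains some
`K(β)`, so it is `Ā_{α,β}` (`exists_equiv_Abar`).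
-/

namespace TaftDouble

set_option linter.unusedSectionVars false

open TensorProduct Coalgebra WithConv HopfAlgebra

/-! ### Modules over the double and Radford's modules -/

section General

variable {k H : Type*} [Field k] [Ring H] [HopfAlgebra k H]

theorem coactOp_groupLike (p : Module.Dual k H) (g : GroupLike k H) :
    coactOp p g.val = p g.val • g.val := by
  change TensorProduct.rid k H (LinearMap.lTensor H p (comul g.val)) = _
  rw [g.2.comul_eq_tmul_self]
  simp

variable [BijectiveAntipode k H]

theorem counit_coactOp (p : Module.Dual k H) (a : H) :
    (counit (coactOp p a) : k) = p a := by
  rw [coactOp_apply p (ℛ k a), map_sum]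
  conv_rhs => rw [← sum_counit_smul (ℛ k a), map_sum]
  simp [mul_comm]

theorem dualMul_eq_apply_coactOp (p q : Module.Dual k H) (a : H) :
    dualMul p q a = p (coactOp q a) := by
  rw [dualMul_apply p q (ℛ k a), coactOp_apply q (ℛ k a), map_sum]
  simp [mul_comm]

variable (k H) in
/-- The embedding `h ↦ ε ⊗ h` of `H` into its double. -/
noncomputable def doubleOfH : H →ₗ[k] DrinfeldDouble k H :=
  (DrinfeldDouble.equiv k H).symm.toLinearMap ∘ₗ TensorProduct.mk k _ _ counit

variable (k H) in
/-- The embedding `p ↦ p ⊗ 1` of `H*` into the double of `H`. -/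
noncomputable def doubleOfDual : Module.Dual k H →ₗ[k] DrinfeldDouble k H :=
  (DrinfeldDouble.equiv k H).symm.toLinearMap ∘ₗ (TensorProduct.mk k _ _).flip 1

theorem doubleOfDual_mul_eq (p : Module.Dual k H) (d : DrinfeldDouble k H) :
    doubleOfDual k H p * d = opDual p (DrinfeldDouble.equiv k H d) := by
  change (opDual p * opH 1 : Module.End k (Module.Dual k H ⊗[k] H)) d = opDual p d
  rw [opH_one, mul_one]

theorem doubleOfH_mul_eq (h : H) (d : DrinfeldDouble k H) :
    doubleOfH k H h * d = opH h (DrinfeldDouble.equiv k H d) := by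
  change (opDual counit * opH h : Module.End k (Module.Dual k H ⊗[k] H)) d = opH h d
  rw [opDual_counit, one_mul]

theorem doubleOfDual_mul_doubleOfH (p : Module.Dual k H) (h : H) :
    doubleOfDual k H p * doubleOfH k H h = (DrinfeldDouble.equiv k H).symm (p ⊗ₜ h) := by
  rw [doubleOfDual_mul_eq]
  change dualMul p counit ⊗ₜ[k] h = _
  rw [dualMul_counit]
  rfl

theorem doubleOfDual_dualMul (p q : Module.Dual k H) :
    doubleOfDual k H (dualMul p q) = doubleOfDual k H p * doubleOfDual k H q := by
  rw [doubleOfDual_mul_eq]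
  rfl

theorem doubleOfDual_counit : doubleOfDual k H counit = 1 := rfl

theorem doubleOfH_one : doubleOfH k H 1 = 1 := rfl

theorem doubleOfH_mul (a b : H) :
    doubleOfH k H (a * b) = doubleOfH k H a * doubleOfH k H b := by
  have h (c : H) : doubleOfH k H c = opH c (counit ⊗ₜ[k] (1 : H)) := by
    rw [← mul_one (doubleOfH k H c), doubleOfH_mul_eq]
    rfl
  rw [doubleOfH_mul_eq, h, opH_mul, h b]
  rfl

theorem doubleOfDual_smul_radford (χ : H →ₐ[k] k) (p : Module.Dual k H) (m : RadfordModule χ) :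
    doubleOfDual k H p • m =
      (RadfordModule.equiv χ).symm (coactOp p (RadfordModule.equiv χ m)) := by
  refine (RadfordModule.tmul_smul χ p 1 m).trans ?_
  rw [bullet_one]
  rfl

theorem doubleOfH_smul_radford (χ : H →ₐ[k] k) (h : H) (m : RadfordModule χ) :
    doubleOfH k H h • m =
      (RadfordModule.equiv χ).symm (bullet χ h (RadfordModule.equiv χ m)) := by
  refine (RadfordModule.tmul_smul χ counit h m).trans ?_
  rw [coactOp_counit]
  rfl

variable {M : Type*} [AddCommGroup M] [Module k M] [Module (DrinfeldDouble k H) M]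
  [IsScalarTower k (DrinfeldDouble k H) M]

variable (k H M) in
/-- The operators `m ↦ (ε ⊗ h) m` on a module over the double. -/
noncomputable def actH : H →ₗ[k] Module.End k M :=
  (Algebra.lsmul k k M : DrinfeldDouble k H →ₐ[k] Module.End k M).toLinearMap ∘ₗ doubleOfH k H

variable (k H M) in
/-- The operators `m ↦ (p ⊗ 1) m` on a module over the double. -/
noncomputable def actDual : Module.Dual k H →ₗ[k] Module.End k M :=
  (Algebra.lsmul k k M : DrinfeldDouble k H →ₐ[k] Module.End k M).toLinearMap ∘ₗ doubleOfDual k H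

@[simp] theorem actH_apply (h : H) (m : M) : actH k H M h m = doubleOfH k H h • m := rfl

@[simp] theorem actDual_apply (p : Module.Dual k H) (m : M) :
    actDual k H M p m = doubleOfDual k H p • m := rfl

/-- The Yetter-Drinfel'd compatibility holds in every module over the double, since it holds in
the regular module. -/
theorem act_compat (q : Module.Dual k H) :
    conv (actH k H M) (actDual k H M ∘ₗ hitR.flip q) =
      conv (actDual k H M ∘ₗ hitL.flip q) (actH k H M) := by
  ext1 h
  have e := LinearMap.congr_fun (LinearMap.congr_fun (opH_compat q) h) (counit ⊗ₜ[k] (1 : H))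
  rw [conv_apply _ _ (ℛ k h), conv_apply _ _ (ℛ k h)] at e ⊢
  ext m
  have e' := congrArg (fun d => (DrinfeldDouble.equiv k H).symm d • m) e
  simp only [LinearMap.sum_apply, Module.End.mul_apply, map_sum, Finset.sum_smul] at e' ⊢
  have h₁ (a : H) (p : Module.Dual k H) :
      (DrinfeldDouble.equiv k H).symm (opH a (opDual p (counit ⊗ₜ[k] (1 : H)))) • m =
        actH k H M a (actDual k H M p m) := by
    rw [actH_apply, actDual_apply, ← mul_smul, doubleOfH_mul_eq]
    rw [← mul_one (doubleOfDual k H p), doubleOfDual_mul_eq]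
    rfl
  have h₂ (a : H) (p : Module.Dual k H) :
      (DrinfeldDouble.equiv k H).symm (opDual p (opH a (counit ⊗ₜ[k] (1 : H)))) • m =
        actDual k H M p (actH k H M a m) := by
    rw [actH_apply, actDual_apply, ← mul_smul, doubleOfDual_mul_eq]
    rw [← mul_one (doubleOfH k H a), doubleOfH_mul_eq]
    rfl
  simpa only [LinearMap.comp_apply, h₁, h₂] using e'

theorem apply_bullet (χ : H →ₐ[k] k) (p : Module.Dual k H) (h a : H) :
    p (bullet χ h a) = ∑ i ∈ (ℛ k h).index, ∑ j ∈ (ℛ k ((ℛ k h).right i)).index,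
      χ ((ℛ k ((ℛ k h).right i)).left j) *
        hitR ((ℛ k ((ℛ k h).right i)).right j)
          (hitL (antipodeInv k ((ℛ k h).left i)) p) a := by
  rw [bullet_apply χ (ℛ k h) (fun i => ℛ k ((ℛ k h).right i))]
  simp [Finset.sum_mul]

section Induced

variable [FiniteDimensional k H] (χ : H →ₐ[k] k) (f : Module.Dual k M)

/-- The map `m ↦ ∑ f(m₍₀₎) m₍₁₎` from a module over the double to `H`, where the right coaction
`m ↦ ∑ m₍₀₎ ⊗ m₍₁₎` is dual to the action of `H*`. -/
noncomputable def matrixCoeff : M →ₗ[k] H :=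
  (Module.evalEquiv k H).symm.toLinearMap ∘ₗ LinearMap.flip
    (f.compRight k ∘ₗ actDual k H M)

theorem apply_matrixCoeff (p : Module.Dual k H) (m : M) :
    p (matrixCoeff (H := H) f m) = f (doubleOfDual k H p • m) := by
  simp [matrixCoeff]

variable {χ f}

theorem matrixCoeff_doubleOfDual_smul (p : Module.Dual k H) (m : M) :
    matrixCoeff f (doubleOfDual k H p • m) = coactOp p (matrixCoeff f m) := by
  rw [← sub_eq_zero, ← Module.forall_dual_apply_eq_zero_iff k]
  intro r
  rw [map_sub, sub_eq_zero, ← dualMul_eq_apply_coactOp, apply_matrixCoeff, apply_matrixCoeff,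
    doubleOfDual_dualMul, mul_smul]

theorem matrixCoeff_doubleOfH_smul (hf : ∀ (h : H) (m : M), f (doubleOfH k H h • m) = χ h * f m)
    (h : H) (m : M) :
    matrixCoeff f (doubleOfH k H h • m) = bullet χ h (matrixCoeff f m) := by
  rw [← sub_eq_zero, ← Module.forall_dual_apply_eq_zero_iff k]
  intro p
  rw [map_sub, sub_eq_zero, apply_matrixCoeff, apply_bullet]
  have e := congrArg f (LinearMap.congr_fun (cross_relation' (actH k H M) (actDual k H M)
    act_compat (ℛ k h) (fun i => ℛ k ((ℛ k h).right i)) p) m)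
  simp only [LinearMap.sum_apply, Module.End.mul_apply, actH_apply, actDual_apply, map_sum,
    hf] at e
  simp only [apply_matrixCoeff]
  exact e.symm

/-- Frobenius reciprocity: a functional `f` on a module over the double on which `H` acts through
the character `χ` induces a homomorphism `m ↦ ∑ f(m₍₀₎) m₍₁₎` to `H_χ`. -/
noncomputable def toRadford (hf : ∀ (h : H) (m : M), f (doubleOfH k H h • m) = χ h * f m) :
    M →ₗ[DrinfeldDouble k H] RadfordModule χ where
  toFun m := (RadfordModule.equiv χ).symm (matrixCoeff f m)
  map_add' m m' := by simp
  map_smul' d m := by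
    rw [RingHom.id_apply]
    suffices key : ∀ d : Module.Dual k H ⊗[k] H,
        (RadfordModule.equiv χ).symm
            (matrixCoeff f ((DrinfeldDouble.equiv k H).symm d • m)) =
          (DrinfeldDouble.equiv k H).symm d • (RadfordModule.equiv χ).symm (matrixCoeff f m) from
      key (DrinfeldDouble.equiv k H d)
    intro d
    induction d with
    | zero => simp
    | add d₁ d₂ h₁ h₂ => simp only [map_add, add_smul, h₁, h₂]
    | tmul p h =>
      rw [← doubleOfDual_mul_doubleOfH, mul_smul, mul_smul, doubleOfH_smul_radford,
        doubleOfDual_smul_radford, matrixCoeff_doubleOfDual_smul, matrixCoeff_doubleOfH_smul hf]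
      rfl

theorem toRadford_ne_zero (hf : ∀ (h : H) (m : M), f (doubleOfH k H h • m) = χ h * f m)
    (hf₀ : f ≠ 0) : toRadford hf ≠ 0 := by
  contrapose! hf₀
  ext m
  have h : matrixCoeff (H := H) f m = 0 :=
    congrArg (RadfordModule.equiv χ) (LinearMap.congr_fun hf₀ m)
  have e := apply_matrixCoeff (H := H) f counit m
  rw [h, map_zero, doubleOfDual_counit, one_smul] at e
  exact e.symm

end Induced

theorem bullet_mem_of_groupLike_mem {χ : H →ₐ[k] k} {g : GroupLike k H}
    {N : Submodule (DrinfeldDouble k H) (RadfordModule χ)}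
    (hg : (RadfordModule.equiv χ).symm g.val ∈ N) : radfordSubmodule χ g ≤ N := by
  rintro _ ⟨h, rfl⟩
  exact doubleOfH_smul_radford χ h ((RadfordModule.equiv χ).symm g.val) ▸ N.smul_mem _ hg

theorem groupLike_mem_radfordSubmodule (χ : H →ₐ[k] k) (g : GroupLike k H) :
    (RadfordModule.equiv χ).symm g.val ∈ radfordSubmodule χ g :=
  ⟨1, by rw [bullet_one]; rfl⟩

end General

/-! ### Products of elements that commute up to scalars -/

section SkewCommute

variable {k R : Type*} [Field k] [Ring R] [Algebra k R]

theorem exists_mul_list_prod_eq_smul (z : R) (l : List R)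
    (h : ∀ y ∈ l, ∃ c : k, z * y = c • (y * z)) :
    ∃ c : k, z * l.prod = c • (l.prod * z) := by
  induction l with
  | nil => exact ⟨1, by simp⟩
  | cons y l ih =>
    obtain ⟨c, hc⟩ := h y (by simp)
    obtain ⟨d, hd⟩ := ih fun y hy => h y (by simp [hy])
    exact ⟨c * d, by
      rw [List.prod_cons, ← mul_assoc, hc, smul_mul_assoc, mul_assoc, hd, mul_smul_comm,
        smul_smul, mul_assoc]⟩

theorem exists_mul_prod_ofFn_pow_eq_smul {n : ℕ} (z : R) (y : Fin n → R) (γ : Fin n → ℕ)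
    (h : ∀ i, ∃ c : k, z * y i = c • (y i * z)) :
    ∃ c : k, z * (List.ofFn fun i => y i ^ γ i).prod =
      c • ((List.ofFn fun i => y i ^ γ i).prod * z) := by
  refine exists_mul_list_prod_eq_smul z _ fun w hw => ?_
  obtain ⟨i, rfl⟩ := List.mem_ofFn.mp hw
  obtain ⟨c, hc⟩ := h i
  exact ⟨c ^ γ i, q_comm_pow hc _⟩

theorem exists_mul_prod_ofFn_pow_eq_smul_update {n : ℕ} (y : Fin n → R)
    (h : ∀ i j, ∃ c : k, y i * y j = c • (y j * y i)) (γ : Fin n → ℕ) (i : Fin n) :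
    ∃ c : k, y i * (List.ofFn fun j => y j ^ γ j).prod =
      c • (List.ofFn fun j => y j ^ Function.update γ i (γ i + 1) j).prod := by
  induction n with
  | zero => exact i.elim0
  | succ n ih =>
    simp only [List.ofFn_succ, List.prod_cons]
    cases i using Fin.cases with
    | zero => exact ⟨1, by simp [← mul_assoc, ← pow_succ']⟩
    | succ i =>
      obtain ⟨c, hc⟩ := h i.succ 0
      obtain ⟨d, hd⟩ := ih (fun j => y j.succ) (fun i j => h _ _) (fun j => γ j.succ) i
      refine ⟨c ^ γ 0 * d, ?_⟩
      have e : ∀ j : Fin n, Function.update γ i.succ (γ i.succ + 1) j.succ =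
          Function.update (fun j => γ j.succ) i (γ i.succ + 1) j := by
        intro j
        simp [Function.update_apply]
      simp only [e]
      rw [← mul_assoc, q_comm_pow hc, smul_mul_assoc, mul_assoc, hd, mul_smul_comm, smul_smul,
        Function.update_of_ne (Fin.succ_ne_zero i).symm]

end SkewCommute

namespace TaftAlgebra

variable {k : Type*} [Field k] {n ℓ : ℕ} {q : k} [NeZero ℓ] [hq : Fact (IsPrimitiveRoot q ℓ)]

/-! ### The group-like elements `K(β)` -/

theorem groupK_val (β : Fin n → ℕ) :
    (groupK k ℓ q β).val = (List.ofFn fun i => (K i : TaftAlgebra k n ℓ q) ^ β i).prod := by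
  have h : ∀ l : List (GroupLike k (TaftAlgebra k n ℓ q)),
      l.prod.val = (l.map GroupLike.val).prod := by
    intro l
    induction l with
    | nil => rfl
    | cons a l ih => simp [ih]
  rw [groupK, h, List.map_ofFn]
  rfl

theorem groupK_zero : (groupK k ℓ q (0 : Fin n → ℕ)).val = 1 := by
  simp [groupK_val]

theorem K_mul_groupK (i : Fin n) (β : Fin n → ℕ) :
    K i * (groupK k ℓ q β).val = (groupK k ℓ q (Function.update β i (β i + 1))).val := by
  obtain ⟨c, hc⟩ := exists_mul_prod_ofFn_pow_eq_smul_update (k := k)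
    (fun i => (K i : TaftAlgebra k n ℓ q)) (fun i j => ⟨1, by rw [one_smul, K_comm]⟩) β i
  rw [← groupK_val, ← groupK_val] at hc
  -- The counit takes the value `1` on both sides.
  have h := congrArg (counit (R := k)) hc
  rw [Bialgebra.counit_mul, map_smul, (groupK k ℓ q β).2.counit_eq_one,
    (groupK k ℓ q _).2.counit_eq_one, (isGroupLikeElem_K i).counit_eq_one, smul_eq_mul, mul_one,
    mul_one] at h
  rw [hc, ← h, one_smul]

theorem K_mul_groupK_comm (i : Fin n) (β : Fin n → ℕ) :
    K i * (groupK k ℓ q β).val = (groupK k ℓ q β).val * K i := by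
  obtain ⟨c, hc⟩ := exists_mul_prod_ofFn_pow_eq_smul (k := k) (K i : TaftAlgebra k n ℓ q) K β
    (fun j => ⟨1, by rw [one_smul, K_comm]⟩)
  rw [← groupK_val] at hc
  have h := congrArg (counit (R := k)) hc
  rw [map_smul, Bialgebra.counit_mul, Bialgebra.counit_mul, (groupK k ℓ q β).2.counit_eq_one,
    (isGroupLikeElem_K i).counit_eq_one, smul_eq_mul, mul_one, mul_one] at h
  rw [hc, ← h, one_smul]

theorem groupK_mod (β : Fin n → ℕ) :
    groupK k ℓ q (fun i => β i % ℓ) = groupK k ℓ q β := by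
  refine GroupLike.val_injective ?_
  simp only [groupK_val]
  congr 2 with i
  exact (pow_eq_pow_mod _ (K_pow i)).symm

theorem mod_le_kappa (β : Fin n → ℕ) : (fun i => β i % ℓ) ≤ kappa n ℓ := fun _ =>
  Nat.le_sub_one_of_lt (Nat.mod_lt _ (NeZero.pos ℓ))

theorem Kinv_eq_pow (i : Fin n) : (Kinv i : TaftAlgebra k n ℓ q) = K i ^ (ℓ - 1) := by
  rw [← mul_one (Kinv i), ← K_pow i, ← Nat.sub_add_cancel (NeZero.one_le : 1 ≤ ℓ), pow_succ',
    ← mul_assoc, Kinv_K, one_mul, Nat.add_sub_cancel]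

/-- A left ideal that contains `1` is everything, and stability under the `K(ε_i)⁻¹` is automatic
as these are powers of the `K(ε_i)`. -/
theorem eq_top_of_left_stable (S : Submodule k (TaftAlgebra k n ℓ q)) (h1 : 1 ∈ S)
    (hK : ∀ i, ∀ a ∈ S, K i * a ∈ S) (hx : ∀ i, ∀ a ∈ S, x i * a ∈ S) : S = ⊤ := by
  have key : ∀ a : TaftAlgebra k n ℓ q, ∀ s ∈ S, a * s ∈ S := by
    intro a
    induction a using gen_induction with
    | hK i => exact hK i
    | hKinv i =>
      intro s hs
      rw [Kinv_eq_pow]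
      induction ℓ - 1 with
      | zero => simpa
      | succ m ih => rw [pow_succ', mul_assoc]; exact hK i _ ih
    | hx i => exact hx i
    | hs c => intro s hs; rw [← Algebra.smul_def]; exact S.smul_mem c hs
    | hadd a b ha hb => intro s hs; rw [add_mul]; exact S.add_mem (ha s hs) (hb s hs)
    | hmul a b ha hb => intro s hs; rw [mul_assoc]; exact ha _ (hb s hs)
  exact eq_top_iff.mpr fun a _ => mul_one a ▸ key a 1 h1

/-- The span of the group-like elements `K(β)`. -/
noncomputable def groupSpan (k : Type*) [Field k] (n ℓ : ℕ) (q : k) [NeZero ℓ]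
    [Fact (IsPrimitiveRoot q ℓ)] : Submodule k (TaftAlgebra k n ℓ q) :=
  Submodule.span k (Set.range fun β => (groupK k ℓ q β).val)

theorem groupK_mem_groupSpan (β : Fin n → ℕ) : (groupK k ℓ q β).val ∈ groupSpan k n ℓ q :=
  Submodule.subset_span ⟨β, rfl⟩

theorem one_mem_groupSpan : 1 ∈ groupSpan k n ℓ q :=
  groupK_zero (k := k) (n := n) (ℓ := ℓ) (q := q) ▸ groupK_mem_groupSpan 0

theorem K_mul_mem_groupSpan (i : Fin n) {a : TaftAlgebra k n ℓ q} (ha : a ∈ groupSpan k n ℓ q) :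
    K i * a ∈ groupSpan k n ℓ q := by
  induction ha using Submodule.span_induction with
  | mem a ha =>
    obtain ⟨β, rfl⟩ := ha
    dsimp only
    rw [K_mul_groupK]
    exact groupK_mem_groupSpan _
  | zero => simp
  | add a b _ _ ha hb => rw [mul_add]; exact Submodule.add_mem _ ha hb
  | smul c a _ ha => rw [mul_smul_comm]; exact Submodule.smul_mem _ c ha

/-! ### Finite dimension -/

/-- The monomials `x_1^{γ_1} ⋯ x_n^{γ_n} K(β)` with exponents less than `ℓ` span. -/
theorem span_monomials_eq_top : Submodule.span k (Set.range
    fun γβ : (Fin n → Fin ℓ) × (Fin n → Fin ℓ) =>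
      (List.ofFn fun i => (x i : TaftAlgebra k n ℓ q) ^ (γβ.1 i : ℕ)).prod *
        (groupK k ℓ q fun i => (γβ.2 i : ℕ)).val) = ⊤ := by
  set S := Submodule.span k (Set.range
    fun γβ : (Fin n → Fin ℓ) × (Fin n → Fin ℓ) =>
      (List.ofFn fun i => (x i : TaftAlgebra k n ℓ q) ^ (γβ.1 i : ℕ)).prod *
        (groupK k ℓ q fun i => (γβ.2 i : ℕ)).val) with hS
  have hmem : ∀ γ β : Fin n → ℕ, (List.ofFn fun i => (x i : TaftAlgebra k n ℓ q) ^ γ i).prod *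
      (groupK k ℓ q β).val ∈ S := by
    intro γ β
    by_cases hγ : ∀ i, γ i < ℓ
    · refine Submodule.subset_span ⟨(fun i => ⟨γ i, hγ i⟩,
        fun i => ⟨β i % ℓ, Nat.mod_lt _ (NeZero.pos ℓ)⟩), ?_⟩
      simp only [groupK_mod]
    · push Not at hγ
      obtain ⟨i, hi⟩ := hγ
      have h0 : (List.ofFn fun i => (x i : TaftAlgebra k n ℓ q) ^ γ i).prod = 0 := by
        refine List.prod_eq_zero (List.mem_ofFn.mpr ⟨i, ?_⟩)
        exact pow_eq_zero_of_le hi (x_pow i)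
      rw [h0, zero_mul]
      exact S.zero_mem
  have hstable : ∀ z : TaftAlgebra k n ℓ q, (∀ γ β : Fin n → ℕ,
      z * ((List.ofFn fun i => (x i : TaftAlgebra k n ℓ q) ^ γ i).prod *
        (groupK k ℓ q β).val) ∈ S) → ∀ a ∈ S, z * a ∈ S := by
    intro z hz a ha
    induction ha using Submodule.span_induction with
    | mem a ha => obtain ⟨γβ, rfl⟩ := ha; exact hz _ _
    | zero => simp
    | add a b _ _ ha hb => rw [mul_add]; exact Submodule.add_mem _ ha hb
    | smul c a _ ha => rw [mul_smul_comm]; exact Submodule.smul_mem _ c ha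
  refine eq_top_of_left_stable S ?_ (fun i => hstable _ fun γ β => ?_)
    (fun i => hstable _ fun γ β => ?_)
  · simpa [groupK_zero] using hmem 0 0
  · obtain ⟨c, hc⟩ := exists_mul_prod_ofFn_pow_eq_smul (k := k) (K i : TaftAlgebra k n ℓ q) x γ
      fun j => ⟨_, K_x i j⟩
    rw [← mul_assoc, hc, smul_mul_assoc, mul_assoc, K_mul_groupK]
    exact S.smul_mem _ (hmem _ _)
  · obtain ⟨c, hc⟩ := exists_mul_prod_ofFn_pow_eq_smul_update (k := k)
      (x : Fin n → TaftAlgebra k n ℓ q) (fun i j => ⟨_, x_x i j⟩) γ i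
    rw [← mul_assoc, hc, smul_mul_assoc]
    exact S.smul_mem _ (hmem _ _)

instance : FiniteDimensional k (TaftAlgebra k n ℓ q) :=
  ⟨span_monomials_eq_top (k := k) (n := n) (ℓ := ℓ) (q := q) ▸
    Submodule.fg_span (Set.finite_range _)⟩

/-! ### Pointedness -/

theorem coactOp_x_mul (p : Module.Dual k (TaftAlgebra k n ℓ q)) (i : Fin n)
    (a : TaftAlgebra k n ℓ q) :
    coactOp p (x i * a) = x i * coactOp p a + K i * coactOp (hitR (x i) p) a := by
  rw [coactOp_apply _ (ℛ k a), coactOp_apply _ (ℛ k a)]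
  change TensorProduct.rid k _ (LinearMap.lTensor _ p (comul (x i * a))) = _
  rw [Bialgebra.comul_mul, comul_eq (x i), comulHom_x]
  nth_rw 1 [← (ℛ k a).eq]
  simp [Finset.mul_sum, add_mul, Finset.sum_add_distrib]

/-- The filtration of `Ā_q(n)` by the degree in the `x_i`: the `m`-th piece is spanned by the
products of an element `K(β)` and at most `m` generators `x_i`. -/
noncomputable def xFiltration (k : Type*) [Field k] (n ℓ : ℕ) (q : k) [NeZero ℓ]
    [Fact (IsPrimitiveRoot q ℓ)] : ℕ → Submodule k (TaftAlgebra k n ℓ q)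
  | 0 => groupSpan k n ℓ q
  | m + 1 => xFiltration k n ℓ q m ⊔
      ⨆ i, (xFiltration k n ℓ q m).map (LinearMap.mulLeft k (x i))

theorem xFiltration_le_succ (m : ℕ) : xFiltration k n ℓ q m ≤ xFiltration k n ℓ q (m + 1) :=
  le_sup_left

theorem x_mul_mem_xFiltration (i : Fin n) {m : ℕ} {a : TaftAlgebra k n ℓ q}
    (ha : a ∈ xFiltration k n ℓ q m) : x i * a ∈ xFiltration k n ℓ q (m + 1) :=
  (le_sup_right : _ ≤ xFiltration k n ℓ q (m + 1))
    (Submodule.mem_iSup_of_mem i (Submodule.mem_map_of_mem ha))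

theorem xFiltration_succ_le {m : ℕ} {S : Submodule k (TaftAlgebra k n ℓ q)}
    (h₁ : xFiltration k n ℓ q m ≤ S) (h₂ : ∀ i, ∀ a ∈ xFiltration k n ℓ q m, x i * a ∈ S) :
    xFiltration k n ℓ q (m + 1) ≤ S := by
  refine sup_le h₁ (iSup_le fun i => ?_)
  rw [Submodule.map_le_iff_le_comap]
  exact h₂ i

theorem K_mul_mem_xFiltration (i : Fin n) (m : ℕ) : ∀ a ∈ xFiltration k n ℓ q m,
    K i * a ∈ xFiltration k n ℓ q m := by
  induction m with
  | zero => exact fun a ha => K_mul_mem_groupSpan i ha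
  | succ m ih =>
    refine xFiltration_succ_le (S := (xFiltration k n ℓ q (m + 1)).comap
      (LinearMap.mulLeft k (K i))) (fun a ha => xFiltration_le_succ m (ih a ha)) fun j a ha => ?_
    rw [Submodule.mem_comap, LinearMap.mulLeft_apply, ← mul_assoc, K_x, smul_mul_assoc, mul_assoc]
    exact Submodule.smul_mem _ _ (x_mul_mem_xFiltration j (ih a ha))

theorem iSup_xFiltration : ⨆ m, xFiltration k n ℓ q m = ⊤ := by
  have hd : Directed (· ≤ ·) (xFiltration k n ℓ q) :=
    (monotone_nat_of_le_succ xFiltration_le_succ).directed_le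
  refine eq_top_of_left_stable _ (Submodule.mem_iSup_of_mem 0 one_mem_groupSpan) ?_ ?_
  · intro i a ha
    obtain ⟨m, hm⟩ := (Submodule.mem_iSup_of_directed _ hd).mp ha
    exact Submodule.mem_iSup_of_mem m (K_mul_mem_xFiltration i m a hm)
  · intro i a ha
    obtain ⟨m, hm⟩ := (Submodule.mem_iSup_of_directed _ hd).mp ha
    exact Submodule.mem_iSup_of_mem (m + 1) (x_mul_mem_xFiltration i hm)

theorem exists_mem_xFiltration (a : TaftAlgebra k n ℓ q) : ∃ m, a ∈ xFiltration k n ℓ q m := by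
  have hd : Directed (· ≤ ·) (xFiltration k n ℓ q) :=
    (monotone_nat_of_le_succ xFiltration_le_succ).directed_le
  exact (Submodule.mem_iSup_of_directed _ hd).mp 
    (iSup_xFiltration (k := k) (n := n) (ℓ := ℓ) (q := q) ▸ Submodule.mem_top)

theorem coactOp_mem_groupSpan (p : Module.Dual k (TaftAlgebra k n ℓ q))
    {a : TaftAlgebra k n ℓ q} (ha : a ∈ groupSpan k n ℓ q) : coactOp p a ∈ groupSpan k n ℓ q := by
  induction ha using Submodule.span_induction with
  | mem a ha =>
    obtain ⟨β, rfl⟩ := ha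
    dsimp only
    rw [coactOp_groupLike]
    exact Submodule.smul_mem _ _ (groupK_mem_groupSpan β)
  | zero => simp
  | add a b _ _ ha hb => rw [map_add]; exact Submodule.add_mem _ ha hb
  | smul c a _ ha => rw [map_smul]; exact Submodule.smul_mem _ c ha

theorem coactOp_mem_xFiltration (m : ℕ) : ∀ (p : Module.Dual k (TaftAlgebra k n ℓ q)),
    ∀ a ∈ xFiltration k n ℓ q m, coactOp p a ∈ xFiltration k n ℓ q m := by
  induction m with
  | zero => exact fun p a ha => coactOp_mem_groupSpan p ha
  | succ m ih =>
    intro p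
    refine xFiltration_succ_le (S := (xFiltration k n ℓ q (m + 1)).comap (coactOp p))
      (fun a ha => xFiltration_le_succ m (ih p a ha)) fun i a ha => ?_
    rw [Submodule.mem_comap, coactOp_x_mul]
    exact Submodule.add_mem _ (x_mul_mem_xFiltration i (ih p a ha))
      (xFiltration_le_succ m (K_mul_mem_xFiltration i m _ (ih _ a ha)))

theorem coactOp_eq_zero_of_mem_groupSpan {p : Module.Dual k (TaftAlgebra k n ℓ q)}
    (hp : groupSpan k n ℓ q ≤ LinearMap.ker p) {a : TaftAlgebra k n ℓ q}
    (ha : a ∈ groupSpan k n ℓ q) : coactOp p a = 0 := by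
  induction ha using Submodule.span_induction with
  | mem a ha =>
    obtain ⟨β, rfl⟩ := ha
    dsimp only
    rw [coactOp_groupLike, LinearMap.mem_ker.mp (hp (groupK_mem_groupSpan β)), zero_smul]
  | zero => simp
  | add a b _ _ ha hb => rw [map_add, ha, hb, add_zero]
  | smul c a _ ha => rw [map_smul, ha, smul_zero]

/-- Functionals that vanish on the group-like elements lower the degree in the `x_i`. -/
theorem coactOp_mem_xFiltration_of_succ {p : Module.Dual k (TaftAlgebra k n ℓ q)}
    (hp : groupSpan k n ℓ q ≤ LinearMap.ker p) (m : ℕ) :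
    ∀ a ∈ xFiltration k n ℓ q (m + 1), coactOp p a ∈ xFiltration k n ℓ q m := by
  induction m with
  | zero =>
    refine xFiltration_succ_le (S := (xFiltration k n ℓ q 0).comap (coactOp p))
      (fun a ha => coactOp_mem_xFiltration _ p a ha) fun i a ha => ?_
    rw [Submodule.mem_comap, coactOp_x_mul, coactOp_eq_zero_of_mem_groupSpan hp ha, mul_zero,
      zero_add]
    exact K_mul_mem_xFiltration i _ _ (coactOp_mem_xFiltration _ _ a ha)
  | succ m ih =>
    refine xFiltration_succ_le (S := (xFiltration k n ℓ q (m + 1)).comap (coactOp p))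
      (fun a ha => coactOp_mem_xFiltration _ p a ha) fun i a ha => ?_
    rw [Submodule.mem_comap, coactOp_x_mul]
    exact Submodule.add_mem _ (x_mul_mem_xFiltration i (ih a ha))
      (K_mul_mem_xFiltration i _ _ (coactOp_mem_xFiltration _ _ a ha))

/-- Functionals that vanish on the group-like elements can be applied until they all kill the
result, which then lies in the span of the group-like elements. -/
theorem exists_coactOp_mem_groupSpan {a : TaftAlgebra k n ℓ q} (ha₀ : a ≠ 0) :
    ∃ p : Module.Dual k (TaftAlgebra k n ℓ q),
      coactOp p a ∈ groupSpan k n ℓ q ∧ coactOp p a ≠ 0 := by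
  obtain ⟨m, hm⟩ := exists_mem_xFiltration a
  induction m generalizing a with
  | zero => exact ⟨counit (R := k), by rw [coactOp_counit]; exact hm, by rwa [coactOp_counit]⟩
  | succ m ih =>
    by_cases ha : a ∈ groupSpan k n ℓ q
    · exact ⟨counit (R := k), by rw [coactOp_counit]; exact ha, by rwa [coactOp_counit]⟩
    · obtain ⟨p, hpa, hp⟩ := Submodule.exists_le_ker_of_notMem ha
      -- `coactOp p a` is not zero, since the counit takes the value `p a` on it.
      have hne : coactOp p a ≠ 0 := fun h => hpa (by rw [← counit_coactOp, h, map_zero])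
      obtain ⟨r, hr, hr₀⟩ := ih hne (coactOp_mem_xFiltration_of_succ hp m a hm)
      exact ⟨dualMul r p, by rwa [coactOp_mul], by rwa [coactOp_mul]⟩

/-- `Ā_q(n)` is pointed: every nonzero subcomodule contains some `K(β)`. -/
theorem exists_coactOp_eq_groupK {a : TaftAlgebra k n ℓ q} (ha₀ : a ≠ 0) :
    ∃ (p : Module.Dual k (TaftAlgebra k n ℓ q)) (β : Fin n → ℕ), β ≤ kappa n ℓ ∧
      coactOp p a = (groupK k ℓ q β).val := by
  suffices key : ∀ a ∈ groupSpan k n ℓ q, a ≠ 0 →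
      ∃ (p : Module.Dual k (TaftAlgebra k n ℓ q)) (β : Fin n → ℕ), β ≤ kappa n ℓ ∧
      coactOp p a = (groupK k ℓ q β).val by
    obtain ⟨p, hp, hp₀⟩ := exists_coactOp_mem_groupSpan ha₀
    obtain ⟨r, β, hβ, hr⟩ := key _ hp hp₀
    exact ⟨dualMul r p, β, hβ, by rw [coactOp_mul]; exact hr⟩
  clear! a
  intro a ha ha₀
  have hspan : groupSpan k n ℓ q =
      Submodule.span k (GroupLike.val '' Set.range (groupK k ℓ q)) := by
    rw [groupSpan, ← Set.range_comp]
    rfl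
  rw [hspan, Finsupp.mem_span_image_iff_linearCombination] at ha
  obtain ⟨c, hc, rfl⟩ := ha
  have hc₀ : c ≠ 0 := by rintro rfl; simp at ha₀
  obtain ⟨g, hg⟩ := Finsupp.ne_iff.mp hc₀
  obtain ⟨β, rfl⟩ := hc (Finsupp.mem_support_iff.mpr hg)
  -- A functional that is dual to `K(β)` on the linearly independent set of group-like elements.
  obtain ⟨p, hp⟩ : ∃ p : Module.Dual k (TaftAlgebra k n ℓ q),
      ∀ g : GroupLike k (TaftAlgebra k n ℓ q), p g.val =
        Finsupp.single (groupK k ℓ q β) (c (groupK k ℓ q β))⁻¹ g := by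
    obtain ⟨G, hG⟩ := (Finsupp.linearCombination k (GroupLike.val (R := k)
      (A := TaftAlgebra k n ℓ q))).exists_leftInverse_of_injective
        (LinearMap.ker_eq_bot.mpr linearIndep_groupLikeVal)
    refine ⟨(c (groupK k ℓ q β))⁻¹ • Finsupp.lapply (groupK k ℓ q β) ∘ₗ G, fun g => ?_⟩
    have h := LinearMap.congr_fun hG (Finsupp.single g 1)
    rw [LinearMap.comp_apply, Finsupp.linearCombination_single, one_smul] at h
    rw [LinearMap.smul_apply, LinearMap.comp_apply, h]
    classical
    simp [Finsupp.single_apply, eq_comm]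
  refine ⟨p, fun i => β i % ℓ, mod_le_kappa β, ?_⟩
  rw [groupK_mod, Finsupp.linearCombination_apply, Finsupp.sum, map_sum]
  simp only [map_smul, coactOp_groupLike, hp]
  rw [Finset.sum_eq_single (groupK k ℓ q β)]
  · rw [Finsupp.single_eq_same, smul_smul, mul_inv_cancel₀ hg, one_smul]
  · intro g _ hne
    rw [Finsupp.single_eq_of_ne hne, zero_smul, smul_zero]
  · intro h
    exact absurd (Finsupp.mem_support_iff.mpr hg) h

end TaftAlgebra

namespace TaftAlgebra

variable {k : Type*} [Field k] {n ℓ : ℕ} {q : k} [NeZero ℓ] [hq : Fact (IsPrimitiveRoot q ℓ)]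

/-! ### Simplicity of the modules `Ā_{α,β}` -/

theorem antipodeInv_K (i : Fin n) : antipodeInv k (K i : TaftAlgebra k n ℓ q) = Kinv i := by
  apply antipode_inj (k := k)
  rw [antipode_antipodeInv]
  exact (antipodeLin_Kinv i).symm

theorem antipodeInv_Kinv (i : Fin n) : antipodeInv k (Kinv i : TaftAlgebra k n ℓ q) = K i := by
  apply antipode_inj (k := k)
  rw [antipode_antipodeInv]
  exact (antipodeLin_K i).symm

theorem antipodeInv_x (i : Fin n) :
    antipodeInv k (x i : TaftAlgebra k n ℓ q) = -(x i * Kinv i) := by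
  apply antipode_inj (k := k)
  rw [antipode_antipodeInv]
  change x i = antipodeLin _
  rw [map_neg, antipodeLin_mul, antipodeLin_x, antipodeLin_Kinv, mul_neg, neg_neg, ← mul_assoc,
    K_Kinv, one_mul]

section Bullet

variable {W : Type*} [AddCommGroup W] [Module k W]

theorem conv_K (f g : TaftAlgebra k n ℓ q →ₗ[k] Module.End k W) (i : Fin n) :
    conv f g (K i) = f (K i) * g (K i) := by
  change LinearMap.mul' k _ (TensorProduct.map f g (comulHom (K i))) = _
  simp [comulHom_K]

theorem conv_Kinv (f g : TaftAlgebra k n ℓ q →ₗ[k] Module.End k W) (i : Fin n) :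
    conv f g (Kinv i) = f (Kinv i) * g (Kinv i) := by
  change LinearMap.mul' k _ (TensorProduct.map f g (comulHom (Kinv i))) = _
  simp [comulHom_Kinv]

theorem conv_x (f g : TaftAlgebra k n ℓ q →ₗ[k] Module.End k W) (i : Fin n) :
    conv f g (x i) = f (x i) * g 1 + f (K i) * g (x i) := by
  change LinearMap.mul' k _ (TensorProduct.map f g (comulHom (x i))) = _
  simp [comulHom_x]

end Bullet

variable (χ : TaftAlgebra k n ℓ q →ₐ[k] k)

theorem bullet_K (i : Fin n) (a : TaftAlgebra k n ℓ q) :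
    bullet χ (K i) a = χ (K i) • (K i * a * Kinv i) := by
  rw [bullet, conv_K, conv_K]
  simp [rightOp, scalarOp, antipodeInv_K]

theorem bullet_Kinv (i : Fin n) (a : TaftAlgebra k n ℓ q) :
    bullet χ (Kinv i) a = χ (Kinv i) • (Kinv i * a * K i) := by
  rw [bullet, conv_Kinv, conv_Kinv]
  simp [rightOp, scalarOp, antipodeInv_Kinv]

/-- The two terms both raise the degree in the `x_i`; the omitted third term vanishes with
`χ(x_i)`. -/
theorem bullet_x (hχ : ∀ i, χ (x i) = 0) (i : Fin n) (a : TaftAlgebra k n ℓ q) :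
    bullet χ (x i) a = χ (K i) • (x i * a * Kinv i) - a * (x i * Kinv i) := by
  rw [bullet, conv_x, conv_x, conv_K]
  simp [rightOp, scalarOp, antipodeInv_K, antipodeInv_x, hχ]
  abel

variable (k n ℓ q) in
/-- The projection of `Ā_q(n)` to its component of degree `0` in the `x_i`, which is the algebra
homomorphism with `K(ε_i) ↦ K(ε_i)` and `x_i ↦ 0`. -/
noncomputable def degreeZero : TaftAlgebra k n ℓ q →ₐ[k] TaftAlgebra k n ℓ q :=
  lift (fun
    | .K i => K i
    | .Kinv i => Kinv i
    | .x _ => 0) (by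
    intro a b h
    cases h with
    | K_comm i j => simp [K_comm i j]
    | K_Kinv i => simp [K_Kinv]
    | Kinv_K i => simp [Kinv_K]
    | K_pow i => simp [K_pow]
    | K_x i j => simp only [map_mul, map_smul, FreeAlgebra.lift_ι_apply]; simp
    | x_x i j => simp
    | x_pow i => simp [NeZero.ne ℓ])

theorem degreeZero_K (i : Fin n) : degreeZero k n ℓ q (K i) = K i := lift_gen _ _ _

theorem degreeZero_Kinv (i : Fin n) : degreeZero k n ℓ q (Kinv i) = Kinv i := lift_gen _ _ _

theorem degreeZero_x (i : Fin n) : degreeZero k n ℓ q (x i) = 0 := lift_gen _ _ _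

theorem degreeZero_groupK (β : Fin n → ℕ) :
    degreeZero k n ℓ q (groupK k ℓ q β).val = (groupK k ℓ q β).val := by
  rw [groupK_val, map_list_prod, List.map_ofFn]
  congr 2 with i
  simp [degreeZero_K]

/-- The component of degree `0` of `H •_χ K(β)` is the line spanned by `K(β)`. -/
theorem degreeZero_bullet_groupK_mem (hχ : ∀ i, χ (x i) = 0) (β : Fin n → ℕ)
    (h : TaftAlgebra k n ℓ q) :
    degreeZero k n ℓ q (bullet χ h (groupK k ℓ q β).val) ∈ k ∙ (groupK k ℓ q β).val := by
  have key : ∀ h a : TaftAlgebra k n ℓ q, degreeZero k n ℓ q a ∈ k ∙ (groupK k ℓ q β).val →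
      degreeZero k n ℓ q (bullet χ h a) ∈ k ∙ (groupK k ℓ q β).val := by
    have hcomm : ∀ i, ∀ a ∈ k ∙ (groupK k ℓ q β).val, K i * a = a * K i := by
      intro i a ha
      obtain ⟨c, rfl⟩ := Submodule.mem_span_singleton.mp ha
      rw [mul_smul_comm, smul_mul_assoc, K_mul_groupK_comm]
    intro h
    induction h using gen_induction with
    | hK i =>
      intro a ha
      rw [bullet_K, map_smul, map_mul, map_mul, degreeZero_K, degreeZero_Kinv, hcomm i _ ha,
        mul_assoc, K_Kinv, mul_one]
      exact Submodule.smul_mem _ _ ha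
    | hKinv i =>
      intro a ha
      rw [bullet_Kinv, map_smul, map_mul, map_mul, degreeZero_K, degreeZero_Kinv, mul_assoc,
        ← hcomm i _ ha, ← mul_assoc, Kinv_K, one_mul]
      exact Submodule.smul_mem _ _ ha
    | hx i =>
      intro a _
      simp [bullet_x χ hχ, degreeZero_x]
    | hs c =>
      intro a ha
      rw [Algebra.algebraMap_eq_smul_one, map_smul, bullet_one, LinearMap.smul_apply, map_smul]
      exact Submodule.smul_mem _ _ ha
    | hadd h₁ h₂ ih₁ ih₂ =>
      intro a ha
      rw [map_add, LinearMap.add_apply, map_add]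
      exact Submodule.add_mem _ (ih₁ a ha) (ih₂ a ha)
    | hmul h₁ h₂ ih₁ ih₂ =>
      intro a ha
      rw [bullet_mul]
      exact ih₁ _ (ih₂ a ha)
  refine key h _ ?_
  rw [degreeZero_groupK]
  exact Submodule.mem_span_singleton_self _

theorem exists_groupK_mem {N : Submodule (DrinfeldDouble k (TaftAlgebra k n ℓ q))
    (RadfordModule χ)} (hN : N ≠ ⊥) :
    ∃ β ≤ kappa n ℓ, (RadfordModule.equiv χ).symm (groupK k ℓ q β).val ∈ N := by
  obtain ⟨m, hm, hm₀⟩ := N.ne_bot_iff.mp hN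
  obtain ⟨p, β, hβ, h⟩ := exists_coactOp_eq_groupK (a := RadfordModule.equiv χ m)
    ((RadfordModule.equiv χ).map_ne_zero_iff.mpr hm₀)
  exact ⟨β, hβ, by rw [← h, ← doubleOfDual_smul_radford]; exact N.smul_mem _ hm⟩

theorem groupK_ne_zero (β : Fin n → ℕ) : (groupK k ℓ q β).val ≠ 0 :=
  (groupK k ℓ q β).2.ne_zero

theorem isSimpleModule_radfordSubmodule (hχ : ∀ i, χ (x i) = 0) (β : Fin n → ℕ) :
    IsSimpleModule (DrinfeldDouble k (TaftAlgebra k n ℓ q))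
      (radfordSubmodule χ (groupK k ℓ q β)) := by
  rw [isSimpleModule_iff_isAtom]
  refine ⟨fun h => groupK_ne_zero (k := k) (ℓ := ℓ) (q := q) β ?_, fun N hN => ?_⟩
  · have := groupLike_mem_radfordSubmodule χ (groupK k ℓ q β)
    rwa [h, Submodule.mem_bot, EmbeddingLike.map_eq_zero_iff] at this
  · by_contra hN₀
    obtain ⟨β', -, hβ'⟩ := exists_groupK_mem χ hN₀
    -- `K(β')` has degree `0` and lies in `H •_χ K(β)`, so it is a multiple of `K(β)`.
    obtain ⟨h, hh⟩ := hN.le hβ'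
    have e := degreeZero_bullet_groupK_mem χ hχ β h
    rw [← (RadfordModule.equiv χ).symm.injective hh, degreeZero_groupK] at e
    obtain ⟨c, hc⟩ := Submodule.mem_span_singleton.mp e
    -- The counit shows that the two elements are equal.
    have hc₁ := congrArg (counit (R := k)) hc
    rw [map_smul, (groupK k ℓ q β).2.counit_eq_one, (groupK k ℓ q β').2.counit_eq_one,
      smul_eq_mul, mul_one] at hc₁
    rw [hc₁, one_smul] at hc
    rw [← hc] at hβ'
    exact hN.not_ge (bullet_mem_of_groupLike_mem hβ')

theorem calK_K (α : Fin n → ℕ) (i : Fin n) : calK k ℓ q α (K i) = q ^ α i := lift_gen _ _ _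

theorem calK_Kinv (α : Fin n → ℕ) (i : Fin n) : calK k ℓ q α (Kinv i) = (q ^ α i)⁻¹ :=
  lift_gen _ _ _

theorem calK_x (α : Fin n → ℕ) (i : Fin n) : calK k ℓ q α (x i) = 0 := lift_gen _ _ _

end TaftAlgebra

/-! ### Common eigenvectors -/

section Eigen

variable {k V ι : Type*} [Field k] [IsAlgClosed k] [AddCommGroup V] [Module k V]
  [FiniteDimensional k V]

theorem exists_inf_eigenspace_ne_bot (T : Module.End k V) {W : Submodule k V} (hW : W ≠ ⊥)
    (hT : ∀ v ∈ W, T v ∈ W) : ∃ μ, W ⊓ T.eigenspace μ ≠ ⊥ := by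
  have : Nontrivial W := Submodule.nontrivial_iff_ne_bot.mpr hW
  obtain ⟨μ, hμ⟩ := Module.End.exists_eigenvalue (T.restrict hT)
  obtain ⟨w, hw⟩ := hμ.exists_hasEigenvector
  refine ⟨μ, (Submodule.ne_bot_iff _).mpr ⟨w, ⟨w.2, ?_⟩, fun h => hw.2 (Subtype.ext h)⟩⟩
  exact Module.End.mem_eigenspace_iff.mpr (congrArg Subtype.val hw.apply_eq_smul)

/-- Finitely many operators that preserve each other's eigenspaces have a common eigenvector in
every nonzero subspace that they all preserve. -/
theorem exists_common_eigenvector [Finite ι] (T : ι → Module.End k V) {W : Submodule k V}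
    (hW : W ≠ ⊥) (hT : ∀ i, ∀ v ∈ W, T i v ∈ W)
    (hE : ∀ i j (μ : k) v, T i v = μ • v → T i (T j v) = μ • T j v) :
    ∃ v ∈ W, v ≠ 0 ∧ ∀ i, ∃ μ : k, T i v = μ • v := by
  classical
  cases nonempty_fintype ι
  have key : ∀ s : Finset ι, ∃ W' ≤ W, W' ≠ ⊥ ∧ (∀ i, ∀ v ∈ W', T i v ∈ W') ∧
      ∀ i ∈ s, ∃ μ : k, ∀ v ∈ W', T i v = μ • v := by
    intro s
    induction s using Finset.induction with
    | empty => exact ⟨W, le_rfl, hW, hT, by simp⟩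
    | insert i s _ ih =>
      obtain ⟨W', hle, hne, hst, hs⟩ := ih
      obtain ⟨μ, hμ⟩ := exists_inf_eigenspace_ne_bot (T i) hne (hst i)
      refine ⟨W' ⊓ (T i).eigenspace μ, inf_le_left.trans hle, hμ, fun j v hv => ⟨hst j v hv.1, ?_⟩,
        fun j hj => ?_⟩
      · exact Module.End.mem_eigenspace_iff.mpr
          (hE i j μ v (Module.End.mem_eigenspace_iff.mp hv.2))
      · rcases Finset.mem_insert.mp hj with rfl | hj
        · exact ⟨μ, fun v hv => Module.End.mem_eigenspace_iff.mp hv.2⟩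
        · obtain ⟨ν, hν⟩ := hs j hj
          exact ⟨ν, fun v hv => hν v hv.1⟩
  obtain ⟨W', hle, hne, -, h⟩ := key Finset.univ
  obtain ⟨v, hv, hv₀⟩ := W'.ne_bot_iff.mp hne
  refine ⟨v, hle hv, hv₀, fun i => ?_⟩
  obtain ⟨μ, hμ⟩ := h i (Finset.mem_univ i)
  exact ⟨μ, hμ v hv⟩

end Eigen

namespace TaftAlgebra

variable {k : Type*} [Field k] {n ℓ : ℕ} {q : k} [NeZero ℓ] [hq : Fact (IsPrimitiveRoot q ℓ)]

/-! ### Classification of the simple modules -/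

instance : FiniteDimensional k (DrinfeldDouble k (TaftAlgebra k n ℓ q)) :=
  inferInstanceAs (FiniteDimensional k
    (Module.Dual k (TaftAlgebra k n ℓ q) ⊗[k] TaftAlgebra k n ℓ q))

section Functional

variable {M : Type*} [AddCommGroup M] [Module k M]
  [Module (DrinfeldDouble k (TaftAlgebra k n ℓ q)) M]
  [IsScalarTower k (DrinfeldDouble k (TaftAlgebra k n ℓ q)) M]

theorem apply_pow_smul {f : Module.Dual k M} {h : TaftAlgebra k n ℓ q} {μ : k}
    (hf : ∀ m, f (doubleOfH k _ h • m) = μ * f m) (j : ℕ) (m : M) :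
    f (doubleOfH k _ (h ^ j) • m) = μ ^ j * f m := by
  induction j generalizing m with
  | zero => rw [pow_zero, pow_zero, doubleOfH_one, one_smul, one_mul]
  | succ j ih => rw [pow_succ, doubleOfH_mul, mul_smul, ih, hf, pow_succ, mul_assoc]

theorem eq_zero_of_apply_x_smul {f : Module.Dual k M} (hf₀ : f ≠ 0) {i : Fin n} {μ : k}
    (hf : ∀ m, f (doubleOfH k (TaftAlgebra k n ℓ q) (x i) • m) = μ * f m) : μ = 0 := by
  obtain ⟨m, hm⟩ := DFunLike.ne_iff.mp hf₀
  have h := apply_pow_smul hf ℓ m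
  rw [x_pow, map_zero, zero_smul, map_zero] at h
  exact eq_zero_of_pow_eq_zero ((mul_eq_zero.mp h.symm).resolve_right hm)

theorem exists_eq_pow_of_apply_K_smul {f : Module.Dual k M} (hf₀ : f ≠ 0) {i : Fin n} {μ : k}
    (hf : ∀ m, f (doubleOfH k (TaftAlgebra k n ℓ q) (K i) • m) = μ * f m) :
    ∃ a < ℓ, q ^ a = μ := by
  obtain ⟨m, hm⟩ := DFunLike.ne_iff.mp hf₀
  have h := apply_pow_smul hf ℓ m
  rw [K_pow, doubleOfH_one, one_smul] at h
  exact hq.out.eq_pow_of_pow_eq_one (mul_right_cancel₀ hm (h.symm.trans (one_mul _).symm))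

/-- A functional that is a common eigenvector of the generators transforms under `Ā_q(n)` by some
character `𝒦(α)`. -/
theorem apply_doubleOfH_smul {f : Module.Dual k M} {α : Fin n → ℕ}
    (hK : ∀ i m, f (doubleOfH k (TaftAlgebra k n ℓ q) (K i) • m) = q ^ α i * f m)
    (hx : ∀ i m, f (doubleOfH k (TaftAlgebra k n ℓ q) (x i) • m) = 0)
    (h : TaftAlgebra k n ℓ q) (m : M) : f (doubleOfH k _ h • m) = calK k ℓ q α h * f m := by
  induction h using gen_induction generalizing m with
  | hK i => rw [hK, calK_K]
  | hKinv i =>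
    have e := hK i (doubleOfH k (TaftAlgebra k n ℓ q) (Kinv i) • m)
    rw [← mul_smul, ← doubleOfH_mul, K_Kinv, doubleOfH_one, one_smul] at e
    rw [calK_Kinv, e, inv_mul_cancel_left₀ (pow_ne_zero _ (q_ne_zero hq.out))]
  | hx i => rw [hx, calK_x, zero_mul]
  | hs c =>
    rw [Algebra.algebraMap_eq_smul_one, (doubleOfH k _).map_smul, doubleOfH_one, smul_assoc,
      one_smul, map_smul, map_smul, map_one, smul_eq_mul, smul_eq_mul, mul_one]
  | hadd a b ha hb => rw [map_add, add_smul, map_add, ha, hb, map_add, add_mul]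
  | hmul a b ha hb => rw [doubleOfH_mul, mul_smul, ha, hb, map_mul, mul_assoc]

/-- The `x_i` act nilpotently and commute up to scalars, and the `K(ε_i)` commute and preserve the
common kernel of the transposed `x_i`. -/
theorem exists_weight_functional [IsAlgClosed k] [FiniteDimensional k M] [Nontrivial M] :
    ∃ α ≤ kappa n ℓ, ∃ f : Module.Dual k M, f ≠ 0 ∧ ∀ (h : TaftAlgebra k n ℓ q) (m : M),
      f (doubleOfH k _ h • m) = calK k ℓ q α h * f m := by
  let X : Fin n → Module.End k (Module.Dual k M) := fun i =>
    (actH k (TaftAlgebra k n ℓ q) M (x i)).dualMap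
  let Y : Fin n → Module.End k (Module.Dual k M) := fun i =>
    (actH k (TaftAlgebra k n ℓ q) M (K i)).dualMap
  have hX (i f m) : X i f m = f (doubleOfH k (TaftAlgebra k n ℓ q) (x i) • m) := rfl
  have hY (i f m) : Y i f m = f (doubleOfH k (TaftAlgebra k n ℓ q) (K i) • m) := rfl
  have hX₀ : ∀ i (μ : k) (f : Module.Dual k M), X i f = μ • f → X i f = 0 := by
    intro i μ f h
    by_cases hf : f = 0
    · rw [hf, map_zero]
    · rw [h, eq_zero_of_apply_x_smul hf fun m => LinearMap.congr_fun h m, zero_smul]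
  obtain ⟨f₀, -, hf₀, hX₁⟩ := exists_common_eigenvector X (W := ⊤) top_ne_bot
    (fun _ _ _ => Submodule.mem_top) (fun i j μ f h => by
      have h₀ := hX₀ i μ f h
      have h₁ : X i (X j f) = 0 := by
        ext m
        rw [hX, hX, ← mul_smul, ← doubleOfH_mul, x_x, (doubleOfH k _).map_smul, smul_assoc,
          map_smul, doubleOfH_mul, mul_smul, ← hX, h₀]
        simp
      by_cases hf : f = 0
      · simp [hf]
      · rw [h₁, eq_zero_of_apply_x_smul hf fun m => LinearMap.congr_fun h m, zero_smul])
  obtain ⟨f, hfW, hf, hY₁⟩ := exists_common_eigenvector Y (W := ⨅ i, LinearMap.ker (X i))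
    ((Submodule.ne_bot_iff _).mpr ⟨f₀, by
      rw [Submodule.mem_iInf]
      intro i
      obtain ⟨μ, hμ⟩ := hX₁ i
      exact hX₀ i μ f₀ hμ, hf₀⟩)
    (fun j f hf => by
      rw [Submodule.mem_iInf] at hf ⊢
      intro i
      rw [LinearMap.mem_ker]
      ext m
      rw [hX, hY, ← mul_smul, ← doubleOfH_mul, K_x, (doubleOfH k _).map_smul, smul_assoc, map_smul,
        doubleOfH_mul, mul_smul (doubleOfH k _ (x i)), ← hX, LinearMap.mem_ker.mp (hf i)]
      simp)
    (fun i j μ f h => by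
      ext m
      rw [hY, hY, ← mul_smul, ← doubleOfH_mul, K_comm, doubleOfH_mul, mul_smul, ← hY, h]
      rfl)
  have hα : ∀ i, ∃ a < ℓ, ∀ m,
      f (doubleOfH k (TaftAlgebra k n ℓ q) (K i) • m) = q ^ a * f m := by
    intro i
    obtain ⟨μ, hμ⟩ := hY₁ i
    have hμ' (m) : f (doubleOfH k (TaftAlgebra k n ℓ q) (K i) • m) = μ * f m :=
      LinearMap.congr_fun hμ m
    obtain ⟨a, ha, rfl⟩ := exists_eq_pow_of_apply_K_smul hf hμ'
    exact ⟨a, ha, hμ'⟩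
  choose α hα hK using hα
  refine ⟨α, fun i => Nat.le_sub_one_of_lt (hα i), f, hf, apply_doubleOfH_smul hK fun i m => ?_⟩
  rw [← hX, LinearMap.mem_ker.mp ((Submodule.mem_iInf _).mp hfW i), LinearMap.zero_apply]

end Functional

/-- A weight functional embeds a simple module in some `H_χ`; the image contains some `K(β)`, and
therefore it is `Ā_{α,β}`. -/
theorem exists_equiv_Abar [IsAlgClosed k] (M : Type*) [AddCommGroup M]
    [Module (DrinfeldDouble k (TaftAlgebra k n ℓ q)) M]
    [IsSimpleModule (DrinfeldDouble k (TaftAlgebra k n ℓ q)) M] :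
    ∃ α β : Fin n → ℕ, α ≤ kappa n ℓ ∧ β ≤ kappa n ℓ ∧
      Nonempty (M ≃ₗ[DrinfeldDouble k (TaftAlgebra k n ℓ q)] Abar k ℓ q α β) := by
  let D := DrinfeldDouble k (TaftAlgebra k n ℓ q)
  let _ : Module k M := Module.compHom M (algebraMap k D)
  have : IsScalarTower k D M := ⟨fun c d m => by
    rw [Algebra.smul_def, mul_smul]
    rfl⟩
  have : Nontrivial M := IsSimpleModule.nontrivial D M
  have : FiniteDimensional k M := by
    obtain ⟨m, hm⟩ := exists_ne (0 : M)
    exact Module.Finite.of_surjective ((LinearMap.toSpanSingleton D M m).restrictScalars k)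
      (IsSimpleModule.toSpanSingleton_surjective D hm)
  obtain ⟨α, hα, f, hf, h⟩ := exists_weight_functional (k := k) (n := n) (ℓ := ℓ) (q := q) (M := M)
  have hF := toRadford_ne_zero h hf
  have hinj : Function.Injective (toRadford h) :=
    (LinearMap.injective_or_eq_zero _).resolve_right hF
  let e := LinearEquiv.ofInjective (toRadford h) hinj
  have : IsSimpleModule D (LinearMap.range (toRadford h)) := IsSimpleModule.congr e.symm
  obtain ⟨β, hβ, hmem⟩ := exists_groupK_mem (calK k ℓ q α)
    (N := LinearMap.range (toRadford h)) (by rwa [ne_eq, LinearMap.range_eq_bot])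
  have hatom : IsAtom (LinearMap.range (toRadford h)) := isSimpleModule_iff_isAtom.mp this
  have hne : Abar k ℓ q α β ≠ ⊥ :=
    (isSimpleModule_iff_isAtom.mp (isSimpleModule_radfordSubmodule _ (calK_x α) β)).1
  exact ⟨α, β, hα, hβ, ⟨e.trans (LinearEquiv.ofEq _ _
    (hatom.le_iff_eq hne |>.mp (bullet_mem_of_groupLike_mem hmem)).symm)⟩⟩

end TaftAlgebra

end TaftDouble

theorem theorem5p1 {k : Type*} [Field k] [IsAlgClosed k] [CharZero k] (n ℓ : ℕ) [NeZero ℓ]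
    (q : k) [Fact (IsPrimitiveRoot q ℓ)] :
    (∀ α β : Fin n → ℕ, α ≤ TaftDouble.kappa n ℓ → β ≤ TaftDouble.kappa n ℓ →
      IsSimpleModule (TaftDouble.DrinfeldDouble k (TaftDouble.TaftAlgebra k n ℓ q))
        (TaftDouble.TaftAlgebra.Abar k ℓ q α β)) ∧
    ∀ (M : Type*) [AddCommGroup M]
      [Module (TaftDouble.DrinfeldDouble k (TaftDouble.TaftAlgebra k n ℓ q)) M]
      [IsSimpleModule (TaftDouble.DrinfeldDouble k (TaftDouble.TaftAlgebra k n ℓ q)) M],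
      ∃ α β : Fin n → ℕ, α ≤ TaftDouble.kappa n ℓ ∧ β ≤ TaftDouble.kappa n ℓ ∧
        Nonempty (M ≃ₗ[TaftDouble.DrinfeldDouble k (TaftDouble.TaftAlgebra k n ℓ q)]
          TaftDouble.TaftAlgebra.Abar k ℓ q α β) := by
  exact ⟨fun α β _ _ => TaftDouble.TaftAlgebra.isSimpleModule_radfordSubmodule _
    (TaftDouble.TaftAlgebra.calK_x α) β, fun M => TaftDouble.TaftAlgebra.exists_equiv_Abar M⟩
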